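/- Let $(M,h)=\mathbb H^n/\Gamma$ with $n=4$ be a geometrically finite hyperbolic manifold: $\Gamma$ is a torsion-free group of isometries acting properly discontinuously on $\mathbb H^n$, and $(\mathbb H^n\cup\Omega_\Gamma)/\Gamma$ (with $\Omega_\Gamma$ the complement of the limit set in the sphere at infinity) is the union of a compact set and of finitely many disjoint standard cusp regions $\mathcal C_1,\dots,\mathcal C_{n_c}$. Here $\mathcal C_j$ is the image of $\{x^2+|y|^2\ge R_j\}$, where $(x,y,z)\in[0,\infty)\times\mathbb R^{n-1-f_j}\times\mathbb R^{f_j}$ are upper half-space coordinates that put a parabolic fixed point $p_j$ at infinity, $f_j\in\{1,\dots,n-1\}$ is the rank of the cusp (the rank of a free abelian normal subgroup of finite index in the stabilizer $\Gamma_{p_j}$), and $\Gamma_{p_j}$ preserves $\{x=1,\ y=0\}\cong\mathbb R^{f_j}$ and acts cocompactly on it. Let $\rho$ and $r_1,\dots,r_{n_c}$ be functions on $(\mathbb H^n\cup\Omega_\Gamma)/\Gamma$, smooth up to the boundary $\Omega_\Gamma/\Gamma$, such that $\rho$ is a boundary defining function of $\Omega_\Gamma/\Gamma$ (positive in the interior,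 zero with nonzero differential on the boundary), each $r_j$ is positive and equal to $1$ outside $\mathcal C_j$, and, far enough in the cusp (where $x^2+|y|^2\ge R_j'$ for some $R_j'\ge R_j$), $r_j=(x^2+|y|^2)^{-1/2}$ and $\rho=x\,(x^2+|y|^2)^{-1/2}$. For $\mu=(\mu_0,\mu_1,\dots,\mu_{n_c})\in\mathbb R^{1+n_c}$ put $\sigma^\mu=\rho^{\mu_0}r_1^{\mu_1}\cdots r_{n_c}^{\mu_{n_c}}$. We say that the asymptotic estimate (for $K=-2$) holds for the weight $\mu$ if there are a compact set $M_c\subset M$ and $\delta>0$ such that $$(\Delta^h-2)\,\sigma^\mu\ \ge\ \delta\,\sigma^\mu\quad\text{on } M\setminus M_c,$$ where $\Delta^h=\nabla^*\nabla$ is the (nonnegative) Laplacian of $h$ on functions. Then: 1. If the asymptotic estimate holds for some weight $\mu$ with $\mu_i>0$ for all $i=1,\dots,n_c$, then every cusp has rank $f_i=1$. 2. For every $\mu_0\in(3/2,2)$ there is $\varepsilon>0$, depending only on $\mu_0$, such that whenever all cusps have rank $1$ and $0<\mu_i<\varepsilon$ for $i=1,\dots,n_c$, the asymptotic estimate holds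 for the weight $\mu=(\mu_0,\mu_1,\dots,\mu_{n_c})$. -/

import Mathlib

open scoped ContDiff Topology

noncomputable section

namespace GFHyp

/-! ### Hyperbolic space: the Poincaré ball with its sphere at infinity -/

/-- Euclidean `n`-space. -/
abbrev E (n : ℕ) : Type := EuclideanSpace ℝ (Fin n)

/-- The closed unit ball, that is, hyperbolic space `ℍⁿ` (the open ball) together with its
sphere at infinity. -/
abbrev ClosedBall (n : ℕ) : Type := Metric.closedBall (0 : E n) 1

/-- The points of `ℍⁿ`: the open unit ball. -/
def inner (n : ℕ) : Set (ClosedBall n) := {w | ‖(w : E n)‖ < 1}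

/-- The sphere at infinity. -/
def sphereAtInfinity (n : ℕ) : Set (ClosedBall n) := {w | ‖(w : E n)‖ = 1}

/-- The centre of the ball. -/
def origin (n : ℕ) : ClosedBall n := ⟨0, by simp⟩

/-- Hyperbolic distance (curvature `-1`) in the Poincaré ball:
`sinh (d / 2) = |x - y| / √((1 - |x|²) (1 - |y|²))`. -/
def hypDist {n : ℕ} (x y : E n) : ℝ :=
  2 * Real.arsinh (‖x - y‖ / √((1 - ‖x‖ ^ 2) * (1 - ‖y‖ ^ 2)))

/-- The isometry group of `ℍⁿ`; each isometry is identified with its (unique) continuous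
extension to the closed ball. -/
def HypIsom (n : ℕ) : Subgroup (ClosedBall n ≃ₜ ClosedBall n) where
  carrier := {φ | (∀ w, φ w ∈ inner n ↔ w ∈ inner n) ∧
    ∀ v ∈ inner n, ∀ w ∈ inner n, hypDist (φ v : E n) (φ w) = hypDist (v : E n) w}
  one_mem' := ⟨fun _ => Iff.rfl, fun _ _ _ _ => rfl⟩
  mul_mem' := by
    rintro φ ψ ⟨h1, h2⟩ ⟨k1, k2⟩
    refine ⟨fun w => (h1 (ψ w)).trans (k1 w), fun v hv w hw => ?_⟩
    exact (h2 _ ((k1 v).2 hv) _ ((k1 w).2 hw)).trans (k2 v hv w hw)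
  inv_mem' := by
    rintro φ ⟨h1, h2⟩
    have h3 : ∀ w, φ.symm w ∈ inner n ↔ w ∈ inner n := fun w => by
      rw [← h1 (φ.symm w), φ.apply_symm_apply]
    refine ⟨h3, fun v hv w hw => ?_⟩
    have h4 := h2 (φ.symm v) ((h3 v).2 hv) (φ.symm w) ((h3 w).2 hw)
    rw [φ.apply_symm_apply, φ.apply_symm_apply] at h4
    exact h4.symm

/-- The Riemannian metric of the Poincaré ball, `4 |dx|² / (1 - |x|²)²`, as a matrix field. -/
def ballMetric {n : ℕ} (x : E n) : Matrix (Fin n) (Fin n) ℝ :=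
  (4 / (1 - ‖x‖ ^ 2) ^ 2) • (1 : Matrix (Fin n) (Fin n) ℝ)

/-- The partial derivative `∂ᵢ u`. -/
def pderiv {n : ℕ} (i : Fin n) (u : E n → ℝ) (x : E n) : ℝ :=
  fderiv ℝ u x (EuclideanSpace.single i 1)

/-- The (nonnegative) Laplacian `Δ^g = ∇^* ∇` on functions, in coordinates:
`Δ^g u = - |det g|^(-1/2) ∂ᵢ (|det g|^(1/2) g^{ij} ∂ⱼ u)`. -/
def laplacian {n : ℕ} (g : E n → Matrix (Fin n) (Fin n) ℝ) (u : E n → ℝ) (x : E n) : ℝ :=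
  -(1 / √|(g x).det|) *
    ∑ i, pderiv i (fun y => √|(g y).det| * ∑ j, (g y)⁻¹ i j * pderiv j u y) x

/-! ### Kleinian groups and their quotients -/

/-- `Γ` is a torsion-free group of isometries of `ℍⁿ`, acting properly discontinuously. -/
structure IsTorsionFreeKleinian {n : ℕ} (Γ : Subgroup (ClosedBall n ≃ₜ ClosedBall n)) : Prop where
  isom : Γ ≤ HypIsom n
  torsionFree : ∀ γ ∈ Γ, IsOfFinOrder γ → γ = 1
  properlyDiscontinuous : ∀ K : Set (ClosedBall n), IsCompact K → K ⊆ inner n →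
    {γ | γ ∈ Γ ∧ (γ '' K ∩ K).Nonempty}.Finite

/-- The limit set: the accumulation points of an orbit of a point of `ℍⁿ`. -/
def limitSet {n : ℕ} (Γ : Subgroup (ClosedBall n ≃ₜ ClosedBall n)) : Set (ClosedBall n) :=
  {ξ | AccPt ξ (Filter.principal {w | ∃ γ ∈ Γ, w = γ (origin n)})}

/-- The domain of discontinuity `Ω_Γ` in the sphere at infinity. -/
def Omega {n : ℕ} (Γ : Subgroup (ClosedBall n ≃ₜ ClosedBall n)) : Set (ClosedBall n) :=
  sphereAtInfinity n \ limitSet Γ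

/-- `ℍⁿ ∪ Ω_Γ`. -/
def innerOmega {n : ℕ} (Γ : Subgroup (ClosedBall n ≃ₜ ClosedBall n)) : Set (ClosedBall n) :=
  inner n ∪ Omega Γ

/-- Two points of `S` are equivalent if an element of `Γ` carries one to the other. -/
def orbitSetoid {n : ℕ} (Γ : Subgroup (ClosedBall n ≃ₜ ClosedBall n)) (S : Set (ClosedBall n)) :
    Setoid S where
  r v w := ∃ γ ∈ Γ, γ v = (w : ClosedBall n)
  iseqv :=
    { refl := fun _ => ⟨1, Γ.one_mem, rfl⟩
      symm := by
        rintro v w ⟨γ, hγ, h⟩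
        exact ⟨γ⁻¹, Γ.inv_mem hγ, by rw [← h]; exact γ.symm_apply_apply _⟩
      trans := by
        rintro u v w ⟨γ, hγ, h⟩ ⟨τ, hτ, k⟩
        exact ⟨τ * γ, Γ.mul_mem hτ hγ, by rw [← k, ← h]; rfl⟩ }

/-- The hyperbolic manifold `M = ℍⁿ / Γ`, with the quotient topology. -/
abbrev Mfd {n : ℕ} (Γ : Subgroup (ClosedBall n ≃ₜ ClosedBall n)) : Type :=
  Quotient (orbitSetoid Γ (inner n))

/-- The manifold with boundary `(ℍⁿ ∪ Ω_Γ) / Γ`, with the quotient topology. -/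
abbrev MfdBar {n : ℕ} (Γ : Subgroup (ClosedBall n ≃ₜ ClosedBall n)) : Type :=
  Quotient (orbitSetoid Γ (innerOmega Γ))

/-- The projection `ℍⁿ → M`. -/
def proj {n : ℕ} (Γ : Subgroup (ClosedBall n ≃ₜ ClosedBall n)) (w : inner n) : Mfd Γ :=
  Quotient.mk (orbitSetoid Γ (inner n)) w

/-- The projection `ℍⁿ ∪ Ω_Γ → (ℍⁿ ∪ Ω_Γ) / Γ`. -/
def projBar {n : ℕ} (Γ : Subgroup (ClosedBall n ≃ₜ ClosedBall n)) (w : innerOmega Γ) : MfdBar Γ :=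
  Quotient.mk (orbitSetoid Γ (innerOmega Γ)) w

open Classical in
/-- The lift to `ℍⁿ ∪ Ω_Γ` of a function on the quotient, extended by `0` to the other points
of Euclidean space. -/
def lift {n : ℕ} (Γ : Subgroup (ClosedBall n ≃ₜ ClosedBall n)) (u : MfdBar Γ → ℝ) (x : E n) : ℝ :=
  if h : ∃ w : innerOmega Γ, ((w : ClosedBall n) : E n) = x then u (projBar Γ h.choose) else 0

/-! ### Cusps -/

/-- A parabolic isometry: its only fixed point in the closed ball is the point `p` at infinity. -/
def IsParabolicAt {n : ℕ} (γ : ClosedBall n ≃ₜ ClosedBall n) (p : ClosedBall n) : Prop :=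
  γ ∈ HypIsom n ∧ p ∈ sphereAtInfinity n ∧ ∀ w, γ w = w ↔ w = p

/-- The stabilizer `Γ_p` of a point. -/
def stab {n : ℕ} (Γ : Subgroup (ClosedBall n ≃ₜ ClosedBall n)) (p : ClosedBall n) :
    Subgroup (ClosedBall n ≃ₜ ClosedBall n) where
  carrier := {γ | γ ∈ Γ ∧ γ p = p}
  one_mem' := ⟨Γ.one_mem, rfl⟩
  mul_mem' := by
    rintro φ ψ ⟨h1, h2⟩ ⟨k1, k2⟩
    exact ⟨Γ.mul_mem h1 k1, (congrArg φ k2).trans h2⟩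
  inv_mem' := by
    rintro φ ⟨h1, h2⟩
    exact ⟨Γ.inv_mem h1, (congrArg φ.symm h2).symm.trans (φ.symm_apply_apply p)⟩

/-- `G` has a normal subgroup of finite index that is free abelian of rank `f`. -/
def HasAbelianRank (G : Type) [Group G] (f : ℕ) : Prop :=
  ∃ A : Subgroup G, A.Normal ∧ A.FiniteIndex ∧ Nonempty (A ≃* Multiplicative (Fin f → ℤ))

/-- The unit vector in the direction of the zeroth coordinate. -/
def e0 (n : ℕ) [NeZero n] : E n := EuclideanSpace.single 0 1

/-- The inversion in the sphere of radius `√2` about `-e0`. It is an involution, and an isometry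
between the Poincaré ball and the upper half-space `{X | 0 < X 0}` with metric `|dX|² / (X 0)²`;
it takes `-e0` to the point at infinity of the half-space (here with the junk value `-e0`). -/
def cayley {n : ℕ} [NeZero n] (X : E n) : E n :=
  -e0 n + (2 / ‖X + e0 n‖ ^ 2) • (X + e0 n)

/-- A parabolic fixed point `p` of `Γ`, with upper half-space coordinates
`(x, y, z) ∈ [0, ∞) × ℝ^(n-1-f) × ℝ^f` that put `p` at infinity and are adapted to `Γ_p`:
`f` is the rank of `Γ_p`, and `Γ_p` maps the subspace `ℝ^f = {y = 0}` of the horosphere `{x = 1}`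
to itself, with compact quotient. The coordinates of a point `w ≠ p` are
`X = cayley (chart⁻¹ w)`, where `x = X 0`, the `X i` with `0 < i < n - f` make up `y`, and
those with `n - f ≤ i` make up `z`. -/
structure Cusp {n : ℕ} [NeZero n] (Γ : Subgroup (ClosedBall n ≃ₜ ClosedBall n)) where
  p : ClosedBall n
  parabolic : ∃ γ ∈ Γ, IsParabolicAt γ p
  rank : ℕ
  one_le_rank : 1 ≤ rank
  rank_le : rank ≤ n - 1
  rank_spec : HasAbelianRank (stab Γ p) rank
  chart : ClosedBall n ≃ₜ ClosedBall n
  chart_isom : chart ∈ HypIsom n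
  chart_p : ((chart.symm p : ClosedBall n) : E n) = -e0 n
  invariant : ∀ γ ∈ stab Γ p, ∀ w, w ≠ p →
    (cayley (chart.symm w : E n) 0 = 1 ∧
      ∀ i : Fin n, 0 < i.val → i.val < n - rank → cayley (chart.symm w : E n) i = 0) →
    (cayley (chart.symm (γ w) : E n) 0 = 1 ∧
      ∀ i : Fin n, 0 < i.val → i.val < n - rank → cayley (chart.symm (γ w) : E n) i = 0)
  cocompact : ∃ B : ℝ, ∀ w, w ≠ p →
    (cayley (chart.symm w : E n) 0 = 1 ∧
      ∀ i : Fin n, 0 < i.val → i.val < n - rank → cayley (chart.symm w : E n) i = 0) →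
    ∃ γ ∈ stab Γ p, ‖cayley (chart.symm (γ w) : E n)‖ ≤ B

namespace Cusp

variable {n : ℕ} [NeZero n] {Γ : Subgroup (ClosedBall n ≃ₜ ClosedBall n)}

/-- The upper half-space coordinates `(x, y, z)` at a cusp. -/
def coord (c : Cusp Γ) (w : ClosedBall n) : E n := cayley (c.chart.symm w : E n)

/-- The function `x² + |y|²` in the upper half-space coordinates at a cusp. -/
def normSq (c : Cusp Γ) (w : ClosedBall n) : ℝ :=
  ∑ i : Fin n with i.val < n - c.rank, c.coord w i ^ 2

/-- The region `C_p(R) = {x² + |y|² ≥ R}` of the closed upper half-space. -/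
def region (c : Cusp Γ) (R : ℝ) : Set (ClosedBall n) := {w | w ≠ c.p ∧ R ≤ c.normSq w}

end Cusp

/-- The standard cusp region in `(ℍⁿ ∪ Ω_Γ) / Γ`: the image of `C_p(R)`. -/
def cuspRegion {n : ℕ} [NeZero n] {Γ : Subgroup (ClosedBall n ≃ₜ ClosedBall n)} (c : Cusp Γ)
    (R : ℝ) : Set (MfdBar Γ) :=
  projBar Γ '' {w | (w : ClosedBall n) ∈ c.region R}

/-- `M = ℍⁿ / Γ` is a geometrically finite hyperbolic manifold whose cusps are enumerated as
`cusp 0, …, cusp (nc - 1)`: the space `(ℍⁿ ∪ Ω_Γ) / Γ` is the union of a compact set and of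
disjoint standard cusp regions. -/
structure GeometricallyFinite {n : ℕ} [NeZero n] (Γ : Subgroup (ClosedBall n ≃ₜ ClosedBall n))
    (nc : ℕ) where
  kleinian : IsTorsionFreeKleinian Γ
  cusp : Fin nc → Cusp Γ
  R : Fin nc → ℝ
  R_pos : ∀ j, 0 < R j
  region_subset : ∀ j, (cusp j).region (R j) ⊆ innerOmega Γ
  precisely_invariant : ∀ j, ∀ γ ∈ Γ, γ ∉ stab Γ (cusp j).p →
    Disjoint (γ '' (cusp j).region (R j)) ((cusp j).region (R j))
  disjoint : ∀ i j, i ≠ j → Disjoint (cuspRegion (cusp i) (R i)) (cuspRegion (cusp j) (R j))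
  decomposition : ∃ C₀ : Set (MfdBar Γ), IsCompact C₀ ∧
    C₀ ∪ ⋃ j, cuspRegion (cusp j) (R j) = Set.univ

/-- Boundary defining functions `ρ` (of `H₀`, the closure of `Ω_Γ / Γ`) and `r j` (of the cusp
faces) for the compactification of `M` to a manifold with corners.
Near the `j`-th cusp face this compactification has polar coordinates
`r = (x² + |y|²)^(-1/2)`, `φ = (x, y) / (x² + |y|²)^(1/2)`, and there `r j = r` and
`ρ = φ⁰ = x / (x² + |y|²)^(1/2)`; the function `r j` is `1` outside the `j`-th cusp region. Away
from the cusps, the functions are smooth up to the boundary `Ω_Γ / Γ`, at which `ρ` vanishes to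
first order, and they are positive elsewhere. -/
structure DefiningFunctions {n : ℕ} [NeZero n] {Γ : Subgroup (ClosedBall n ≃ₜ ClosedBall n)}
    {nc : ℕ} (G : GeometricallyFinite Γ nc) where
  ρ : MfdBar Γ → ℝ
  r : Fin nc → MfdBar Γ → ℝ
  ρ_smooth : ContDiffOn ℝ ∞ (lift Γ ρ) (Subtype.val '' innerOmega Γ)
  ρ_pos : ∀ w : innerOmega Γ, (w : ClosedBall n) ∈ inner n → 0 < ρ (projBar Γ w)
  ρ_zero : ∀ w : innerOmega Γ, (w : ClosedBall n) ∈ Omega Γ → ρ (projBar Γ w) = 0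
  ρ_deriv : ∀ w ∈ Omega Γ,
    fderivWithin ℝ (lift Γ ρ) (Subtype.val '' innerOmega Γ) (w : E n) ≠ 0
  r_smooth : ∀ j, ContDiffOn ℝ ∞ (lift Γ (r j)) (Subtype.val '' innerOmega Γ)
  r_pos : ∀ j m, 0 < r j m
  r_eq_one : ∀ j, ∀ m ∉ cuspRegion (G.cusp j) (G.R j), r j m = 1
  cusp_form : ∀ j, ∃ R', G.R j ≤ R' ∧
    ∀ w : innerOmega Γ, (w : ClosedBall n) ∈ (G.cusp j).region R' →
      r j (projBar Γ w) = 1 / √((G.cusp j).normSq w) ∧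
      ρ (projBar Γ w) = (G.cusp j).coord w 0 / √((G.cusp j).normSq w)

/-- The lift to `ℍⁿ` of `σ^μ = ρ^μ₀ r₁^μ₁ ⋯`. -/
def sigmaPow {n : ℕ} [NeZero n] {Γ : Subgroup (ClosedBall n ≃ₜ ClosedBall n)} {nc : ℕ}
    {G : GeometricallyFinite Γ nc} (D : DefiningFunctions G) (μ₀ : ℝ) (μ : Fin nc → ℝ)
    (x : E n) : ℝ :=
  lift Γ D.ρ x ^ μ₀ * ∏ j, lift Γ (D.r j) x ^ μ j

/-- The asymptotic estimate for `Δ^h + K` and the weight `(μ₀, μ)`: for some `δ > 0`,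
`(Δ^h + K) σ^μ ≥ δ σ^μ` outside a compact subset of `M`. As `ℍⁿ → M` is a local isometry, the
Laplacian on `M` is computed on lifts. -/
def AsymptoticEstimate {n : ℕ} [NeZero n] {Γ : Subgroup (ClosedBall n ≃ₜ ClosedBall n)} {nc : ℕ}
    {G : GeometricallyFinite Γ nc} (D : DefiningFunctions G) (K : ℝ) (μ₀ : ℝ) (μ : Fin nc → ℝ) :
    Prop :=
  ∃ Mc : Set (Mfd Γ), IsCompact Mc ∧ ∃ δ : ℝ, 0 < δ ∧
    ∀ w : inner n, proj Γ w ∉ Mc →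
      laplacian ballMetric (sigmaPow D μ₀ μ) (w : ClosedBall n) +
          K * sigmaPow D μ₀ μ (w : ClosedBall n) ≥
        δ * sigmaPow D μ₀ μ (w : ClosedBall n)

end GFHyp

end

open scoped InnerProductSpace

namespace GFHyp

/-! The whole statement is governed by one formula. Far in a cusp of rank `f`, write s = x² + |y|²
and t = x²/s, so 0 < t ≤ 1. There the weight is x^μ₀ s^(-(μ₀+μⱼ)/2), and a computation in the
half-space (`confLap_exp_logModel`, `exists_confLap_sigmaPow_cusp`) gives Δσ/σ = μ₀(3 - μ₀) + t (μ₀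
+ μⱼ)(μ₀ - μⱼ - f). At a point of Ω the quotient Δσ/σ tends to μ₀(3 - μ₀), whatever the smooth
positive factors are (`tendsto_confLap_boundary`).

Necessity of rank one: points far in a cusp leave every compact subset of M
(`exists_forall_proj_not_mem`), so the estimate passes to the model for all available t. At t = 1 it
reads (3 - f)μ₀ - μⱼ² - fμⱼ - 2 ≥ δ. For f = 3 the left side is negative. For f = 2 it forces μ₀ >
2, while t → 0 requires μ₀(3 - μ₀) ≥ 2, that is, 1 ≤ μ₀ ≤ 2.

Sufficiency: for f = 1, μ₀ > 3/2 and 0 < μⱼ < 1/2 the coefficient of t is positive, so Δσ/σ ≥ μ₀(3 -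
μ₀) > 2 far in the cusps. What remains of the quotient is compact, since the part of a cusp region
with s bounded is compact modulo the stabilizer. A finite cover of it consists of neighbourhoods of
boundary points, where the limit above applies, and of pieces with compact closure in M, which are
discarded.

The Laplacian is computed in the ball, the cusp model lives in the half-space, and isometries are
given only as distance-preserving homeomorphisms. The bridge is that isometries are compositions of
linear isometries, similarities and the Cayley inversion (`exists_similarity`,
`exists_laplaceEquivariant`), each of which intertwines the conformally flat Laplacians
(`confLap_comp_conformal`). -/

/-! ### Laplacians of conformally flat metrics -/

/-- The Laplacian of the conformally flat metric `d⁻² |dx|²`, with the sign of `laplacian`. -/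
noncomputable def confLap {n : ℕ} (d u : E n → ℝ) (x : E n) : ℝ :=
  -(d x) ^ 2 * ∑ i, pderiv i (pderiv i u) x + (n - 2) * d x * ∑ i, pderiv i d x * pderiv i u x

/-- The conformal factor `(1 - |x|²) / 2` of the Poincaré ball. -/
noncomputable def ballFactor {n : ℕ} (x : E n) : ℝ := (1 - ‖x‖ ^ 2) / 2

theorem pderiv_congr {n : ℕ} {u v : E n → ℝ} {x : E n} (h : u =ᶠ[𝓝 x] v) (i : Fin n) :
    pderiv i u =ᶠ[𝓝 x] pderiv i v := by
  filter_upwards [h.fderiv (𝕜 := ℝ)] with y hy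
  simp [pderiv, hy]

theorem confLap_congr {n : ℕ} {u v : E n → ℝ} {x : E n} (h : u =ᶠ[𝓝 x] v) (d : E n → ℝ) :
    confLap d u x = confLap d v x := by
  unfold confLap
  congr 2
  · exact Finset.sum_congr rfl fun i _ => (pderiv_congr (pderiv_congr h i) i).self_of_nhds
  · exact Finset.sum_congr rfl fun i _ => by rw [(pderiv_congr h i).self_of_nhds]

theorem _root_.ContDiffAt.differentiableAt_fderiv {n : ℕ} {u : E n → ℝ} {x : E n}
    (hu : ContDiffAt ℝ 2 u x) : DifferentiableAt ℝ (fderiv ℝ u) x :=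
  (hu.fderiv_right (m := 1) (by norm_num)).differentiableAt (by norm_num)

theorem _root_.ContDiffAt.hasFDerivAt_pderiv {n : ℕ} {u : E n → ℝ} {x : E n}
    (hu : ContDiffAt ℝ 2 u x) (i : Fin n) :
    HasFDerivAt (pderiv i u) ((fderiv ℝ (fderiv ℝ u) x).flip (EuclideanSpace.single i 1)) x := by
  have := hu.differentiableAt_fderiv.hasFDerivAt.clm_apply
    (hasFDerivAt_const (EuclideanSpace.single i (1 : ℝ)) x)
  refine this.congr_fderiv ?_
  ext v
  simp

theorem _root_.ContDiffAt.pderiv_pderiv {n : ℕ} {u : E n → ℝ} {x : E n}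
    (hu : ContDiffAt ℝ 2 u x) (i j : Fin n) :
    pderiv i (pderiv j u) x = fderiv ℝ (fderiv ℝ u) x (EuclideanSpace.single i 1)
      (EuclideanSpace.single j 1) := by
  rw [pderiv, (hu.hasFDerivAt_pderiv j).fderiv]
  rfl

theorem hasFDerivAt_ballFactor {n : ℕ} (x : E n) :
    HasFDerivAt (ballFactor (n := n)) (-(innerSL ℝ x)) x := by
  have h := ((hasStrictFDerivAt_norm_sq x).hasFDerivAt.const_sub 1).const_mul (1 / 2 : ℝ)
  refine (h.congr_of_eventuallyEq (.of_forall fun y => ?_)).congr_fderiv ?_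
  · simp [ballFactor]; ring
  · ext v; simp

theorem pderiv_ballFactor {n : ℕ} (i : Fin n) (x : E n) : pderiv i ballFactor x = -x i := by
  simp [pderiv, (hasFDerivAt_ballFactor x).fderiv, EuclideanSpace.inner_single_right]

theorem ballFactor_pos {n : ℕ} {x : E n} (hx : ‖x‖ < 1) : 0 < ballFactor x := by
  have := norm_nonneg x
  unfold ballFactor
  nlinarith

theorem ballMetric_eq {n : ℕ} (x : E n) :
    ballMetric x = ((ballFactor x)⁻¹ ^ 2) • (1 : Matrix (Fin n) (Fin n) ℝ) := by
  unfold ballMetric ballFactor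
  congr 1
  rw [inv_div, div_pow]
  norm_num

/-- With d = `ballFactor`, the volume density is d⁻⁴ and the inverse metric is d², so the flux is
d⁻² ∂ᵢu; expanding its divergence gives the formula. -/
theorem laplacian_ballMetric {u : E 4 → ℝ} {x : E 4} (hx : ‖x‖ < 1) (hu : ContDiffAt ℝ 2 u x) :
    laplacian ballMetric u x = confLap ballFactor u x := by
  have hd : ∀ y : E 4, ‖y‖ < 1 → √|(ballMetric y).det| = (ballFactor y)⁻¹ ^ 4 := by
    intro y hy
    have := ballFactor_pos hy
    rw [ballMetric_eq, Matrix.det_smul, Matrix.det_one, mul_one, Fintype.card_fin, ← pow_mul,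
      abs_of_pos (by positivity), show 2 * 4 = 4 * 2 by norm_num, pow_mul, Real.sqrt_sq (by positivity)]
  have hi : ∀ y : E 4, ‖y‖ < 1 → (ballMetric y)⁻¹ =
      (ballFactor y ^ 2) • (1 : Matrix (Fin 4) (Fin 4) ℝ) := by
    intro y hy
    have := ballFactor_pos hy
    refine Matrix.inv_eq_left_inv ?_
    rw [ballMetric_eq, Matrix.smul_mul, Matrix.mul_smul, smul_smul, one_mul, ← mul_pow,
      mul_inv_cancel₀ this.ne', one_pow, one_smul]
  have hnear : ∀ᶠ y in 𝓝 x, ‖y‖ < 1 := continuous_norm.continuousAt.eventually (gt_mem_nhds hx)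
  have hpos := ballFactor_pos hx
  have key : ∀ i : Fin 4, pderiv i (fun y => √|(ballMetric y).det| *
      ∑ j, (ballMetric y)⁻¹ i j * pderiv j u y) x =
      (ballFactor x)⁻¹ ^ 2 * pderiv i (pderiv i u) x +
        2 * (ballFactor x)⁻¹ ^ 3 * x i * pderiv i u x := by
    intro i
    have h1 : (fun y => √|(ballMetric y).det| * ∑ j, (ballMetric y)⁻¹ i j * pderiv j u y)
        =ᶠ[𝓝 x] fun y => (ballFactor y)⁻¹ ^ 2 * pderiv i u y := by
      filter_upwards [hnear] with y hy
      have := (ballFactor_pos hy).ne'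
      rw [hd y hy, hi y hy]
      simp only [Matrix.smul_apply, Matrix.one_apply, smul_eq_mul, mul_ite, mul_one, mul_zero,
        ite_mul, zero_mul, Finset.sum_ite_eq, Finset.mem_univ, if_true]
      field_simp
    rw [(pderiv_congr h1 i).self_of_nhds]
    have h2 : HasFDerivAt (fun y : E 4 => (ballFactor y)⁻¹ ^ 2) _ x :=
      ((hasDerivAt_inv hpos.ne').comp_hasFDerivAt x (hasFDerivAt_ballFactor x)).pow 2
    have h3 := h2.mul (hu.hasFDerivAt_pderiv i)
    rw [pderiv, HasFDerivAt.fderiv (f := fun y => (ballFactor y)⁻¹ ^ 2 * pderiv i u y) h3,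
      hu.pderiv_pderiv]
    simp [EuclideanSpace.inner_single_right]
    ring
  unfold laplacian confLap
  simp_rw [key, pderiv_ballFactor]
  rw [hd x hx, Finset.sum_add_distrib, ← Finset.mul_sum]
  simp_rw [mul_assoc]
  rw [← Finset.mul_sum, ← Finset.mul_sum]
  simp_rw [neg_mul, Finset.sum_neg_distrib]
  field_simp
  push_cast
  ring

theorem pderiv_exp {n : ℕ} {f : E n → ℝ} {x : E n} (hf : DifferentiableAt ℝ f x) (i : Fin n) :
    pderiv i (fun y => Real.exp (f y)) x = Real.exp (f x) * pderiv i f x := by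
  simp [pderiv, hf.hasFDerivAt.exp.fderiv]

/-- Working with logarithms turns products of powers into linear combinations, at the cost of the
single quadratic term d²|∇f|². -/
theorem confLap_exp {n : ℕ} {f : E n → ℝ} {x : E n} (hf : ContDiffAt ℝ 2 f x) (d : E n → ℝ) :
    confLap d (fun y => Real.exp (f y)) x = Real.exp (f x) *
      (confLap d f x - (d x) ^ 2 * ∑ i, pderiv i f x ^ 2) := by
  have hd : ∀ᶠ y in 𝓝 x, DifferentiableAt ℝ f y :=
    (hf.eventually (by norm_num)).mono fun y hy => hy.differentiableAt (by norm_num)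
  have h2 : ∀ i, pderiv i (pderiv i fun y => Real.exp (f y)) x =
      Real.exp (f x) * (pderiv i (pderiv i f) x + pderiv i f x ^ 2) := by
    intro i
    have h1 : pderiv i (fun y => Real.exp (f y)) =ᶠ[𝓝 x] fun y => Real.exp (f y) * pderiv i f y :=
      hd.mono fun y hy => pderiv_exp hy i
    rw [(pderiv_congr h1 i).self_of_nhds]
    have h3 := hd.self_of_nhds.hasFDerivAt.exp.mul (hf.hasFDerivAt_pderiv i)
    rw [pderiv, HasFDerivAt.fderiv (f := fun y => Real.exp (f y) * pderiv i f y) h3,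
      hf.pderiv_pderiv]
    simp [pderiv]
    ring
  unfold confLap
  simp_rw [h2, pderiv_exp hd.self_of_nhds, ← Finset.mul_sum, Finset.sum_add_distrib]
  have : ∀ i, pderiv i d x * (Real.exp (f x) * pderiv i f x) =
      Real.exp (f x) * (pderiv i d x * pderiv i f x) := fun i => by ring
  simp_rw [this, ← Finset.mul_sum]
  ring

/-! ### Conformal changes of variable -/

/-- Both sums are the trace of the operator that represents `B` through the inner product. -/
theorem sum_bilin_orthonormalBasis {n : ℕ} (B : E n →L[ℝ] E n →L[ℝ] ℝ)
    (f g : OrthonormalBasis (Fin n) ℝ (E n)) : ∑ i, B (f i) (f i) = ∑ i, B (g i) (g i) := by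
  let T : E n →ₗ[ℝ] E n :=
    ((InnerProductSpace.toDual ℝ (E n)).symm.toLinearEquiv.toLinearMap).comp B.toLinearMap
  have hT : ∀ v w, B v w = ⟪w, T v⟫_ℝ := fun v w => by
    rw [real_inner_comm]
    exact (InnerProductSpace.toDual_symm_apply (𝕜 := ℝ) (x := w) (y := B v)).symm
  simp_rw [hT]
  rw [← LinearMap.trace_eq_sum_inner, ← LinearMap.trace_eq_sum_inner]

theorem pderiv_pderiv_comp {n : ℕ} {u : E n → ℝ} {φ : E n → E n} {φ' : E n → E n →L[ℝ] E n}
    {x : E n} (hu : ContDiffAt ℝ 2 u (φ x)) (hφ : ∀ᶠ y in 𝓝 x, HasFDerivAt φ (φ' y) y)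
    (i : Fin n) {ψ : E n →L[ℝ] E n}
    (hψ : HasFDerivAt (fun y => φ' y (EuclideanSpace.single i 1)) ψ x) :
    pderiv i (pderiv i (u ∘ φ)) x =
      fderiv ℝ (fderiv ℝ u) (φ x) (φ' x (EuclideanSpace.single i 1))
        (φ' x (EuclideanSpace.single i 1)) +
      fderiv ℝ u (φ x) (ψ (EuclideanSpace.single i 1)) := by
  have hd : ∀ᶠ y in 𝓝 (φ x), DifferentiableAt ℝ u y :=
    (hu.eventually (by norm_num)).mono fun y hy => hy.differentiableAt (by norm_num)
  have h1 : pderiv i (u ∘ φ) =ᶠ[𝓝 x]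
      fun y => fderiv ℝ u (φ y) (φ' y (EuclideanSpace.single i 1)) := by
    filter_upwards [hφ, hφ.self_of_nhds.continuousAt.eventually hd] with y h1 h2
    rw [pderiv, (h2.hasFDerivAt.comp y h1).fderiv]
    rfl
  rw [(pderiv_congr h1 i).self_of_nhds, pderiv]
  have h2 := (hu.differentiableAt_fderiv.hasFDerivAt.comp x hφ.self_of_nhds).clm_apply hψ
  rw [HasFDerivAt.fderiv (f := fun y => fderiv ℝ u (φ y) (φ' y (EuclideanSpace.single i 1))) h2]
  simp [add_comm]

/-- Behaviour of the Laplacian under a conformal map that is an isometry between `d₁⁻² |dx|²`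
and `d₂⁻² |dx|²` and satisfies the second-order identity that holds for Möbius maps. -/
theorem confLap_comp_conformal {n : ℕ} {u d₁ d₂ m : E n → ℝ} {φ : E n → E n}
    {φ' : E n → E n →L[ℝ] E n} {x : E n} {m' : E n →L[ℝ] ℝ} {ψ : Fin n → E n →L[ℝ] E n}
    (f : OrthonormalBasis (Fin n) ℝ (E n))
    (hu : ContDiffAt ℝ 2 u (φ x)) (hφ : ∀ᶠ y in 𝓝 x, HasFDerivAt φ (φ' y) y)
    (hψ : ∀ i, HasFDerivAt (fun y => φ' y (EuclideanSpace.single i 1)) (ψ i) x)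
    (hf : ∀ i, φ' x (EuclideanSpace.single i 1) = m x • f i)
    (hm : HasFDerivAt m m' x)
    (htension : ∑ i, ψ i (EuclideanSpace.single i 1) =
      -((n : ℝ) - 2) • ∑ i, m' (EuclideanSpace.single i 1) • f i)
    (hd₁ : DifferentiableAt ℝ d₁ x) (hd₂ : DifferentiableAt ℝ d₂ (φ x))
    (hd : ∀ᶠ y in 𝓝 x, d₂ (φ y) = m y * d₁ y) :
    confLap d₁ (u ∘ φ) x = confLap d₂ u (φ x) := by
  have hux : DifferentiableAt ℝ u (φ x) := hu.differentiableAt (by norm_num)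
  have h1 : ∀ i, pderiv i (u ∘ φ) x = m x * fderiv ℝ u (φ x) (f i) := fun i => by
    rw [pderiv, (hux.hasFDerivAt.comp x hφ.self_of_nhds).fderiv]
    simp [hf]
  -- This is the derivative of d₂ ∘ φ = m d₁ in the direction eᵢ.
  have h2 : ∀ i, m x * pderiv i d₁ x =
      m x * fderiv ℝ d₂ (φ x) (f i) - d₁ x * m' (EuclideanSpace.single i 1) := fun i => by
    have e := ((hd₂.hasFDerivAt.comp x hφ.self_of_nhds).congr_of_eventuallyEq
      (f₁ := fun y => m y * d₁ y) (hd.mono fun y hy => hy.symm)).unique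
      (hm.mul hd₁.hasFDerivAt)
    have := congrArg (fun l : E n →L[ℝ] ℝ => l (EuclideanSpace.single i 1)) e
    simp [hf] at this
    unfold pderiv
    linarith
  have h3 : ∑ i, pderiv i (pderiv i (u ∘ φ)) x = m x ^ 2 * ∑ i, pderiv i (pderiv i u) (φ x)
      - (n - 2) * ∑ i, m' (EuclideanSpace.single i 1) * fderiv ℝ u (φ x) (f i) := by
    simp_rw [pderiv_pderiv_comp hu hφ _ (hψ _), hf, hu.pderiv_pderiv]
    rw [Finset.sum_add_distrib, ← map_sum, htension]
    have := sum_bilin_orthonormalBasis (fderiv ℝ (fderiv ℝ u) (φ x)) f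
      (EuclideanSpace.basisFun (Fin n) ℝ)
    simp only [EuclideanSpace.basisFun_apply] at this
    rw [← this]
    simp [Finset.mul_sum, map_sum]
    rw [← Finset.sum_add_distrib, ← Finset.sum_sub_distrib]
    exact Finset.sum_congr rfl fun i _ => by ring
  have h4 : ∑ i, pderiv i d₂ (φ x) * pderiv i u (φ x) =
      ∑ i, fderiv ℝ d₂ (φ x) (f i) * fderiv ℝ u (φ x) (f i) := by
    have := sum_bilin_orthonormalBasis
      ((fderiv ℝ d₂ (φ x)).smulRight (fderiv ℝ u (φ x))) f (EuclideanSpace.basisFun (Fin n) ℝ)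
    simpa [pderiv] using this.symm
  have h5 : ∑ i, pderiv i d₁ x * pderiv i (u ∘ φ) x =
      m x * ∑ i, fderiv ℝ d₂ (φ x) (f i) * fderiv ℝ u (φ x) (f i) -
      d₁ x * ∑ i, m' (EuclideanSpace.single i 1) * fderiv ℝ u (φ x) (f i) := by
    rw [Finset.mul_sum, Finset.mul_sum, ← Finset.sum_sub_distrib]
    refine Finset.sum_congr rfl fun i _ => ?_
    rw [h1, ← mul_assoc, mul_comm (pderiv i d₁ x), h2]
    ring
  -- The terms with the gradient of `m`, one from the second derivatives of φ and one from the
  -- derivative of d₁, cancel.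
  unfold confLap
  rw [h3, h5, h4, hd.self_of_nhds]
  ring

theorem confLap_comp_similarity {n : ℕ} {u d₁ d₂ : E n → ℝ} (A : E n ≃ₗᵢ[ℝ] E n) (b : E n)
    (l : ℝ) {x : E n} (hu : ContDiffAt ℝ 2 u (b + l • A x))
    (hd₁ : DifferentiableAt ℝ d₁ x) (hd₂ : DifferentiableAt ℝ d₂ (b + l • A x))
    (hd : ∀ᶠ y in 𝓝 x, d₂ (b + l • A y) = l * d₁ y) :
    confLap d₁ (fun y => u (b + l • A y)) x = confLap d₂ u (b + l • A x) := by
  have hφ : ∀ y, HasFDerivAt (fun y : E n => b + l • A y)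
      (l • (A.toContinuousLinearEquiv : E n →L[ℝ] E n)) y := fun y =>
    (((A.toContinuousLinearEquiv : E n →L[ℝ] E n).hasFDerivAt).const_smul l).const_add b
  refine confLap_comp_conformal (m := fun _ => l) (m' := 0) (ψ := fun _ => 0)
    (φ := fun y => b + l • A y) (φ' := fun _ => l • (A.toContinuousLinearEquiv : E n →L[ℝ] E n))
    ((EuclideanSpace.basisFun (Fin n) ℝ).map A) hu (.of_forall hφ)
    (fun i => hasFDerivAt_const _ _) (fun i => ?_) (hasFDerivAt_const _ _) ?_ hd₁ hd₂ hd
  · simp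
  · simp

/-! ### The Cayley inversion -/

theorem norm_lt_one_of_ballFactor_pos {X : E n} (h : 0 < ballFactor X) : ‖X‖ < 1 := by
  unfold ballFactor at h
  have := norm_nonneg X
  nlinarith

theorem sum_apply_smul_single (z : E n) : ∑ i, z i • EuclideanSpace.single i (1 : ℝ) = z := by
  have := (EuclideanSpace.basisFun (Fin n) ℝ).sum_repr z
  simpa using this

section Cayley

variable {n : ℕ} [NeZero n]

theorem norm_e0 : ‖e0 n‖ = 1 := by simp [e0]

theorem e0_apply_zero : e0 n 0 = 1 := by simp [e0]

theorem norm_add_e0_sq (X : E n) : ‖X + e0 n‖ ^ 2 = ‖X‖ ^ 2 + 2 * X 0 + 1 := by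
  rw [norm_add_sq_real, norm_e0]
  simp [e0, EuclideanSpace.inner_single_right]

theorem add_e0_ne_zero {X : E n} (h : X ≠ -e0 n) : X + e0 n ≠ 0 :=
  fun h' => h (eq_neg_of_add_eq_zero_left h')

theorem norm_add_e0_pos {X : E n} (h : X ≠ -e0 n) : 0 < ‖X + e0 n‖ :=
  norm_pos_iff.2 (add_e0_ne_zero h)

theorem ne_neg_e0_of_norm_lt {X : E n} (h : ‖X‖ < 1) : X ≠ -e0 n := by
  rintro rfl
  simp [norm_e0] at h

theorem ne_neg_e0_of_nonneg {X : E n} (h : 0 ≤ X 0) : X ≠ -e0 n := by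
  rintro rfl
  simp [e0_apply_zero] at h
  linarith

theorem cayley_add_e0 (X : E n) : cayley X + e0 n = (2 / ‖X + e0 n‖ ^ 2) • (X + e0 n) := by
  simp [cayley]

theorem norm_cayley_add_e0 {X : E n} (h : X ≠ -e0 n) : ‖cayley X + e0 n‖ = 2 / ‖X + e0 n‖ := by
  have := norm_add_e0_pos h
  rw [cayley_add_e0, norm_smul, Real.norm_eq_abs, abs_of_pos (by positivity)]
  field_simp

theorem cayley_ne {X : E n} (h : X ≠ -e0 n) : cayley X ≠ -e0 n := by
  intro h'
  have h1 := norm_cayley_add_e0 h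
  have := norm_add_e0_pos h
  rw [h', neg_add_cancel, norm_zero] at h1
  exact absurd h1 (by positivity)

theorem cayley_cayley {X : E n} (h : X ≠ -e0 n) : cayley (cayley X) = X := by
  have h0 := norm_add_e0_pos h
  rw [cayley, norm_cayley_add_e0 h, cayley_add_e0, smul_smul,
    show 2 / (2 / ‖X + e0 n‖) ^ 2 * (2 / ‖X + e0 n‖ ^ 2) = 1 by field_simp, one_smul]
  abel

theorem cayley_apply_zero {X : E n} (h : X ≠ -e0 n) :
    cayley X 0 = 2 / ‖X + e0 n‖ ^ 2 * ballFactor X := by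
  have h0 := norm_add_e0_pos h
  have h1 := norm_add_e0_sq X
  have : cayley X 0 = -1 + 2 / ‖X + e0 n‖ ^ 2 * (X 0 + 1) := by
    simp [cayley, e0_apply_zero]
    ring
  rw [this, ballFactor]
  field_simp
  linarith

theorem ballFactor_cayley {X : E n} (h : X ≠ -e0 n) :
    ballFactor (cayley X) = 2 / ‖X + e0 n‖ ^ 2 * X 0 := by
  have h0 := norm_add_e0_pos h
  have h1 := cayley_apply_zero (cayley_ne h)
  rw [cayley_cayley h, norm_cayley_add_e0 h] at h1
  rw [h1]
  field_simp

/-- The usual distance formula for an inversion of radius √2. Combined with `cayley_apply_zero` it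
identifies the ball and half-space distances. -/
theorem norm_cayley_sub_sq {X Y : E n} (hX : X ≠ -e0 n) (hY : Y ≠ -e0 n) :
    ‖cayley X - cayley Y‖ ^ 2 = 4 * ‖X - Y‖ ^ 2 / (‖X + e0 n‖ ^ 2 * ‖Y + e0 n‖ ^ 2) := by
  have hX0 := norm_add_e0_pos hX
  have hY0 := norm_add_e0_pos hY
  have h1 : cayley X - cayley Y = (cayley X + e0 n) - (cayley Y + e0 n) := by abel
  have h2 : X - Y = (X + e0 n) - (Y + e0 n) := by abel
  rw [h1, h2, norm_sub_sq_real, norm_sub_sq_real, norm_cayley_add_e0 hX, norm_cayley_add_e0 hY,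
    cayley_add_e0, cayley_add_e0, real_inner_smul_left, real_inner_smul_right]
  field_simp
  ring

theorem cayley_apply_zero_pos {X : E n} (h : ‖X‖ < 1) : 0 < cayley X 0 := by
  have h' := ne_neg_e0_of_norm_lt h
  have := norm_add_e0_pos h'
  have := ballFactor_pos h
  rw [cayley_apply_zero h']
  positivity

theorem norm_cayley_lt_one {X : E n} (h : 0 < X 0) : ‖cayley X‖ < 1 := by
  have h' := ne_neg_e0_of_nonneg h.le
  have := norm_add_e0_pos h'
  refine norm_lt_one_of_ballFactor_pos ?_
  rw [ballFactor_cayley h']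
  positivity

theorem hasFDerivAt_inv_norm_add_e0_sq {X : E n} (h : X ≠ -e0 n) :
    HasFDerivAt (fun Y : E n => (‖Y + e0 n‖ ^ 2)⁻¹)
      ((-2 * (‖X + e0 n‖ ^ 2)⁻¹ ^ 2) • innerSL ℝ (X + e0 n)) X := by
  have h0 := norm_add_e0_pos h
  have h1 := ((hasStrictFDerivAt_norm_sq (X + e0 n)).hasFDerivAt.comp X
    ((hasFDerivAt_id X).add_const (e0 n)))
  have h2 := (hasDerivAt_inv (pow_ne_zero 2 h0.ne')).comp_hasFDerivAt X h1
  refine h2.congr_fderiv ?_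
  ext v
  simp
  ring

theorem contDiffAt_cayley {X : E n} (h : X ≠ -e0 n) : ContDiffAt ℝ ∞ (cayley (n := n)) X := by
  have h0 : ‖X + e0 n‖ ^ 2 ≠ 0 := pow_ne_zero 2 (norm_add_e0_pos h).ne'
  have h1 : ContDiffAt ℝ ∞ (fun X : E n => X + e0 n) X := contDiffAt_id.add contDiffAt_const
  have h2 : ContDiffAt ℝ ∞ (fun X : E n => ‖X + e0 n‖ ^ 2) X := h1.norm_sq ℝ
  have h3 : ContDiffAt ℝ ∞ (fun _ : E n => (2 : ℝ)) X := contDiffAt_const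
  exact contDiffAt_const.add ((h3.div h2 h0).smul h1)

theorem continuousAt_cayley {X : E n} (h : X ≠ -e0 n) : ContinuousAt (cayley (n := n)) X :=
  (contDiffAt_cayley h).continuousAt

/-- The derivative of the inversion at x is the factor 2/|z|² times the reflection in the hyperplane
orthogonal to z = x + e₀, so the map is conformal; the second-order identity is checked by hand. The
two factors d₁, d₂ are left free because the inversion is used in both directions. -/
theorem confLap_comp_cayley {u d₁ d₂ : E n → ℝ} {x : E n} (hx : x ≠ -e0 n)
    (hu : ContDiffAt ℝ 2 u (cayley x))
    (hd₁ : DifferentiableAt ℝ d₁ x) (hd₂ : DifferentiableAt ℝ d₂ (cayley x))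
    (hd : ∀ᶠ y in 𝓝 x, d₂ (cayley y) = 2 / ‖y + e0 n‖ ^ 2 * d₁ y) :
    confLap d₁ (u ∘ cayley) x = confLap d₂ u (cayley x) := by
  set q : E n → ℝ := fun Y => (‖Y + e0 n‖ ^ 2)⁻¹ with hq
  let q' : E n → E n →L[ℝ] ℝ := fun Y => (-2 * q Y ^ 2) • innerSL ℝ (Y + e0 n)
  have hq' : ∀ Y, Y ≠ -e0 n → HasFDerivAt q (q' Y) Y := fun Y hY =>
    hasFDerivAt_inv_norm_add_e0_sq hY
  have hz : ∀ Y : E n, HasFDerivAt (fun Y : E n => Y + e0 n) (ContinuousLinearMap.id ℝ (E n)) Y :=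
    fun Y => (hasFDerivAt_id Y).add_const (e0 n)
  have hm : ∀ Y, Y ≠ -e0 n → HasFDerivAt (fun Y : E n => 2 / ‖Y + e0 n‖ ^ 2) ((2 : ℝ) • q' Y) Y :=
    fun Y hY => ((hq' Y hY).const_mul 2).congr_of_eventuallyEq
      (.of_forall fun y => by simp [hq, div_eq_mul_inv])
  let φ' : E n → E n →L[ℝ] E n := fun Y =>
    (2 / ‖Y + e0 n‖ ^ 2) • ContinuousLinearMap.id ℝ (E n) + ((2 : ℝ) • q' Y).smulRight (Y + e0 n)
  have hφ : ∀ Y, Y ≠ -e0 n → HasFDerivAt cayley (φ' Y) Y := fun Y hY =>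
    ((hm Y hY).smul (hz Y)).const_add (-e0 n)
  have hne : ∀ᶠ y in 𝓝 x, y ≠ -e0 n := isOpen_ne.mem_nhds hx
  set z := x + e0 n with hzdef
  have hz0 : z ≠ 0 := add_e0_ne_zero hx
  have hzp := norm_add_e0_pos hx
  have hqz : q x * ‖z‖ ^ 2 = 1 := inv_mul_cancel₀ (by positivity)
  have hsum : ∑ i, z i ^ 2 = ‖z‖ ^ 2 := by rw [EuclideanSpace.real_norm_sq_eq]
  let e : Fin n → E n := fun i => EuclideanSpace.single i 1
  have hin : ∀ i, ⟪z, e i⟫_ℝ = z i := fun i => by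
    simp [e, EuclideanSpace.inner_single_right]
  have hcoord : ∀ i, HasFDerivAt (fun y : E n => (y + e0 n) i) (innerSL ℝ (e i)) x := fun i => by
    have := (innerSL ℝ (e i)).hasFDerivAt.comp x (hz x)
    refine (this.congr_of_eventuallyEq (.of_forall fun y => ?_)).congr_fderiv ?_
    · simp [e, EuclideanSpace.inner_single_left]
    · ext v; simp
  have hψ : ∀ i, ∃ ψ : E n →L[ℝ] E n, HasFDerivAt (fun y => φ' y (e i)) ψ x ∧
      ψ (e i) = (-8 * q x ^ 2) • (z i • e i) + (-4 * q x ^ 2 + 16 * q x ^ 3 * z i ^ 2) • z := by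
    intro i
    have h1 : HasFDerivAt (fun y => (2 / ‖y + e0 n‖ ^ 2) • e i +
        (-4 * (q y ^ 2 * (y + e0 n) i)) • (y + e0 n)) _ x :=
      ((hm x hx).smul_const (e i)).add
        (((((hq' x hx).pow 2).mul (hcoord i)).const_mul (-4)).smul (hz x))
    refine ⟨_, h1.congr_of_eventuallyEq (.of_forall fun y => ?_), ?_⟩
    · simp [φ', q', e, EuclideanSpace.inner_single_right]
      module
    · have hq1 : (-4 * q x ^ 2 + 16 * q x ^ 3 * z i ^ 2) =
        -4 * (q x ^ 2 * 1 + z i * (2 * q x * (-2 * q x ^ 2 * z i))) := by ring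
      have hee : ⟪e i, e i⟫_ℝ = 1 := by simp [e]
      have hzi : z i = x i + e0 n i := rfl
      simp only [q', add_apply, ContinuousLinearMap.smulRight_apply,
        smul_apply, innerSL_apply_apply, ← hzdef, hin, hee,
        ContinuousLinearMap.id_apply, hq1]
      simp [hzi, q]
      module
  choose ψ hψ hψe using hψ
  -- The orthonormal frame is the image of the standard basis under the reflection in z^⊥.
  refine confLap_comp_conformal (m := fun Y => 2 / ‖Y + e0 n‖ ^ 2) (m' := (2 : ℝ) • q' x) (ψ := ψ)
    (φ := cayley) (φ' := φ')
    ((EuclideanSpace.basisFun (Fin n) ℝ).map (Submodule.reflection (ℝ ∙ z)ᗮ)) hu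
    (hne.mono hφ) hψ (fun i => ?_) (hm x hx) ?_ hd₁ hd₂ hd
  · have hm1 : 2 / ‖x + e0 n‖ ^ 2 = 2 * q x := div_eq_mul_inv _ _
    have hr : ⟪z, e i⟫_ℝ / ‖z‖ ^ 2 = z i * q x := by rw [hin, div_eq_mul_inv]
    rw [OrthonormalBasis.map_apply, EuclideanSpace.basisFun_apply,
      Submodule.reflection_orthogonal_apply, Submodule.reflection_singleton_apply]
    change φ' x (e i) = (2 / ‖x + e0 n‖ ^ 2) • -((2 : ℕ) • (⟪z, e i⟫_ℝ / ‖z‖ ^ 2) • z - e i)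
    have : φ' x (e i) = (2 / ‖x + e0 n‖ ^ 2) • e i + (2 * (-2 * q x ^ 2 * ⟪z, e i⟫_ℝ)) • z := rfl
    rw [this, hr, hin, hm1]
    module
  · have hm' : ∀ i, ((2 : ℝ) • q' x) (EuclideanSpace.single i 1) = -4 * q x ^ 2 * z i := fun i => by
      have : ((2 : ℝ) • q' x) (e i) = 2 * (-2 * q x ^ 2 * ⟪z, e i⟫_ℝ) := rfl
      rw [this, hin]
      ring
    -- Both sides of the second-order identity are multiples of z: the coordinates of z resum to z,
    -- and the reflection takes z to -z.
    have hse : ∑ i, z i • e i = z := sum_apply_smul_single z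
    have h1 : ∑ i, ψ i (e i) = ((8 - 4 * n) * q x ^ 2) • z := by
      simp_rw [hψe]
      rw [Finset.sum_add_distrib, ← Finset.smul_sum, hse, ← Finset.sum_smul,
        Finset.sum_add_distrib, ← Finset.mul_sum Finset.univ (fun i => z i ^ 2), hsum, ← add_smul]
      congr 1
      simp
      linear_combination (16 * q x ^ 2) * hqz
    have h2 : ∑ i, ((2 : ℝ) • q' x) (EuclideanSpace.single i 1) •
        ((EuclideanSpace.basisFun (Fin n) ℝ).map (Submodule.reflection (ℝ ∙ z)ᗮ)) i =
        (4 * q x ^ 2) • z := by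
      simp_rw [hm', OrthonormalBasis.map_apply, EuclideanSpace.basisFun_apply, mul_smul]
      simp_rw [← map_smul (Submodule.reflection (ℝ ∙ z)ᗮ)]
      rw [← map_sum, ← Finset.smul_sum, ← Finset.smul_sum]
      erw [hse]
      rw [map_smul, map_smul, Submodule.reflection_orthogonalComplement_singleton_eq_neg]
      module
    rw [h2]
    refine h1.trans ?_
    module

end Cayley

/-! ### Maps that intertwine Laplacians -/

/-- `φ` is `C²` at `x` and intertwines there the Laplacians of `d₁⁻² |dx|²` and `d₂⁻² |dx|²`. -/
structure LaplaceEquivariantAt {n : ℕ} (d₁ d₂ : E n → ℝ) (φ : E n → E n) (x : E n) : Prop where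
  contDiffAt : ContDiffAt ℝ 2 φ x
  confLap_comp : ∀ u : E n → ℝ, ContDiffAt ℝ 2 u (φ x) →
    confLap d₁ (u ∘ φ) x = confLap d₂ u (φ x)

theorem LaplaceEquivariantAt.comp {n : ℕ} {d₁ d₂ d₃ : E n → ℝ} {φ ψ : E n → E n} {x : E n}
    (hψ : LaplaceEquivariantAt d₂ d₃ ψ (φ x)) (hφ : LaplaceEquivariantAt d₁ d₂ φ x) :
    LaplaceEquivariantAt d₁ d₃ (ψ ∘ φ) x where
  contDiffAt := hψ.contDiffAt.comp x hφ.contDiffAt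
  confLap_comp u hu := by
    rw [← Function.comp_assoc, hφ.confLap_comp _ (ContDiffAt.comp (φ x) hu hψ.contDiffAt), hψ.confLap_comp _ hu]
    rfl

theorem laplaceEquivariantAt_similarity {n : ℕ} {d₁ d₂ : E n → ℝ} (A : E n ≃ₗᵢ[ℝ] E n) (b : E n)
    (l : ℝ) {x : E n} (hd₁ : DifferentiableAt ℝ d₁ x)
    (hd₂ : DifferentiableAt ℝ d₂ (b + l • A x)) (hd : ∀ y, d₂ (b + l • A y) = l * d₁ y) :
    LaplaceEquivariantAt d₁ d₂ (fun y => b + l • A y) x where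
  contDiffAt := contDiffAt_const.add
    ((A.toContinuousLinearEquiv : E n →L[ℝ] E n).contDiff.contDiffAt.const_smul l)
  confLap_comp _ hu := confLap_comp_similarity A b l hu hd₁ hd₂ (.of_forall hd)

theorem differentiableAt_ballFactor {n : ℕ} (x : E n) :
    DifferentiableAt ℝ (ballFactor (n := n)) x := (hasFDerivAt_ballFactor x).differentiableAt

theorem differentiableAt_apply {n : ℕ} (i : Fin n) (x : E n) :
    DifferentiableAt ℝ (fun y : E n => y i) x := by fun_prop

theorem laplaceEquivariantAt_linearIsometry {n : ℕ} (A : E n ≃ₗᵢ[ℝ] E n) (x : E n) :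
    LaplaceEquivariantAt ballFactor ballFactor A x := by
  have := laplaceEquivariantAt_similarity (d₁ := ballFactor) (d₂ := ballFactor) A 0 1
    (differentiableAt_ballFactor x) (differentiableAt_ballFactor _) (fun y => by simp [ballFactor])
  simpa using this

section

variable {n : ℕ} [NeZero n]

theorem laplaceEquivariantAt_cayley_ball {x : E n} (hx : x ≠ -e0 n) :
    LaplaceEquivariantAt ballFactor (fun y => y 0) cayley x where
  contDiffAt := (contDiffAt_cayley hx).of_le (by norm_cast)
  confLap_comp _ hu := confLap_comp_cayley hx hu (differentiableAt_ballFactor _)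
    (differentiableAt_apply _ _)
    ((isOpen_ne.eventually_mem hx).mono fun _ hy => cayley_apply_zero hy)

theorem laplaceEquivariantAt_cayley_halfSpace {x : E n} (hx : x ≠ -e0 n) :
    LaplaceEquivariantAt (fun y => y 0) ballFactor cayley x where
  contDiffAt := (contDiffAt_cayley hx).of_le (by norm_cast)
  confLap_comp _ hu := confLap_comp_cayley hx hu (differentiableAt_apply _ _)
    (differentiableAt_ballFactor _)
    ((isOpen_ne.eventually_mem hx).mono fun _ hy => ballFactor_cayley hy)

end

/-! ### Hyperbolic isometries fixing the point at infinity are similarities -/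

/-- By polarization T - T b multiplies inner products by l². Hence the images of b + r eᵢ, recentred
and rescaled, form an orthonormal basis, and the coefficients of T x - T b in it are l times the
coordinates of x - b. The set only has to contain b and this frame, which allows an open half-space.
-/
theorem exists_linearIsometry_of_norm_sub {n : ℕ} {S : Set (E n)} {T : E n → E n} {b : E n}
    {l r : ℝ} (hl : 0 < l) (hr : 0 < r) (hb : b ∈ S)
    (hS : ∀ i, b + r • EuclideanSpace.single i (1 : ℝ) ∈ S)
    (hT : ∀ x ∈ S, ∀ y ∈ S, ‖T x - T y‖ = l * ‖x - y‖) :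
    ∃ A : E n ≃ₗᵢ[ℝ] E n, ∀ x ∈ S, T x = T b + l • A (x - b) := by
  have hin : ∀ x ∈ S, ∀ y ∈ S, ⟪T x - T b, T y - T b⟫_ℝ = l ^ 2 * ⟪x - b, y - b⟫_ℝ := by
    intro x hx y hy
    have h1 := norm_sub_sq_real (T x - T b) (T y - T b)
    have h2 := norm_sub_sq_real (x - b) (y - b)
    rw [sub_sub_sub_cancel_right] at h1 h2
    rw [hT x hx y hy, hT x hx b hb, hT y hy b hb] at h1
    linear_combination (1 / 2 : ℝ) * h1 - (l ^ 2 / 2) * h2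
  let e : Fin n → E n := fun i => EuclideanSpace.single i 1
  let f : Fin n → E n := fun i => (l * r)⁻¹ • (T (b + r • e i) - T b)
  have hee : ∀ i (x : E n), ⟪e i, x⟫_ℝ = x i := fun i x => by
    simp [e, EuclideanSpace.inner_single_left]
  have hfx : ∀ i, ∀ x ∈ S, ⟪f i, T x - T b⟫_ℝ = l * (x - b) i := fun i x hx => by
    rw [real_inner_smul_left, hin _ (hS i) x hx, add_sub_cancel_left, real_inner_smul_left, hee]
    field_simp
  have hf : Orthonormal ℝ f := by
    rw [orthonormal_iff_ite]
    intro i j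
    rw [show f j = (l * r)⁻¹ • (T (b + r • e j) - T b) from rfl, real_inner_smul_right,
      hfx i _ (hS j), add_sub_cancel_left]
    by_cases h : i = j
    · subst h
      simp
      field_simp
    · simp [h]
  let F : OrthonormalBasis (Fin n) ℝ (E n) := OrthonormalBasis.mk hf
    (hf.linearIndependent.span_eq_top_of_card_eq_finrank' (by simp)).ge
  refine ⟨(EuclideanSpace.basisFun (Fin n) ℝ).equiv F (Equiv.refl _), fun x hx => ?_⟩
  have h1 : T x - T b = ∑ i, (l * (x - b) i) • F i := by
    rw [← F.sum_repr' (T x - T b)]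
    refine Finset.sum_congr rfl fun i _ => ?_
    rw [show F i = f i by simp [F], hfx i x hx]
  have h2 : (EuclideanSpace.basisFun (Fin n) ℝ).equiv F (Equiv.refl _) (x - b) =
      ∑ i, (x - b) i • F i := by
    conv_lhs => rw [← sum_apply_smul_single (x - b)]
    rw [map_sum]
    refine Finset.sum_congr rfl fun i _ => ?_
    rw [map_smul, ← EuclideanSpace.basisFun_apply, OrthonormalBasis.equiv_apply_basis]
    rfl
  rw [h2, Finset.smul_sum, ← sub_eq_iff_eq_add', h1]
  simp_rw [mul_smul]

/-- Invariance of distance with arsinh and the square roots removed; in this form it contains only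
continuous functions and can be pushed to the sphere at infinity. -/
theorem norm_sub_sq_of_mem_hypIsom {n : ℕ} {φ : ClosedBall n ≃ₜ ClosedBall n} (hφ : φ ∈ HypIsom n)
    {v w : ClosedBall n} (hv : v ∈ inner n) (hw : w ∈ inner n) :
    ‖(φ v : E n) - φ w‖ ^ 2 * (ballFactor (v : E n) * ballFactor (w : E n)) =
      ‖(v : E n) - w‖ ^ 2 * (ballFactor (φ v : E n) * ballFactor (φ w : E n)) := by
  have h := hφ.2 v hv w hw
  have p1 := ballFactor_pos hv
  have p2 := ballFactor_pos hw
  have p3 := ballFactor_pos ((hφ.1 v).2 hv)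
  have p4 := ballFactor_pos ((hφ.1 w).2 hw)
  have hb : ∀ x : E n, 1 - ‖x‖ ^ 2 = 2 * ballFactor x := fun x => by unfold ballFactor; ring
  unfold hypDist at h
  have h := Real.arsinh_injective (mul_left_cancel₀ two_ne_zero h)
  have h := congrArg (· ^ 2) h
  simp only [hb, div_pow] at h
  rw [Real.sq_sqrt (by positivity), Real.sq_sqrt (by positivity), div_eq_div_iff (by positivity)
    (by positivity)] at h
  linarith

theorem dense_inner (n : ℕ) : Dense (inner n) := by
  intro w
  rw [Metric.mem_closure_iff]
  intro ε hε
  obtain ⟨⟨w, hw⟩, rfl⟩ : ∃ w', w' = w := ⟨w, rfl⟩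
  have h1 : w ∈ closure (Metric.ball (0 : E n) 1) := by
    rwa [closure_ball _ one_ne_zero]
  obtain ⟨v, hv, hd⟩ := Metric.mem_closure_iff.1 h1 ε hε
  exact ⟨⟨v, Metric.ball_subset_closedBall hv⟩, by simpa [inner] using hv, hd⟩

/-- The action of a linear isometry on the closed ball. -/
noncomputable def linHomeo {n : ℕ} (A : E n ≃ₗᵢ[ℝ] E n) : ClosedBall n ≃ₜ ClosedBall n :=
  A.toHomeomorph.subtype fun x => by simp

@[simp] theorem linHomeo_coe {n : ℕ} (A : E n ≃ₗᵢ[ℝ] E n) (w : ClosedBall n) :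
    (linHomeo A w : E n) = A w := rfl

theorem linHomeo_mem {n : ℕ} (A : E n ≃ₗᵢ[ℝ] E n) : linHomeo A ∈ HypIsom n :=
  ⟨fun w => by simp [inner], fun v _ w _ => by simp [hypDist, ← map_sub]⟩

section

variable {n : ℕ} [NeZero n]

/-- The point `-e0` of the sphere at infinity, which the Cayley transform takes to infinity. -/
noncomputable def south (n : ℕ) [NeZero n] : ClosedBall n := ⟨-e0 n, by simp [norm_e0]⟩

theorem ne_neg_e0_of_ne_south {w : ClosedBall n} (h : w ≠ south n) : (w : E n) ≠ -e0 n :=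
  fun h' => h (Subtype.ext h')

theorem ne_south_of_mem_inner {w : ClosedBall n} (h : w ∈ inner n) : w ≠ south n := by
  rintro rfl
  exact ne_neg_e0_of_norm_lt h rfl

/-- The height in the half-space is a horospherical function: compare the distances from u to v and
to w, and let u tend to the fixed point at infinity. The conclusion says that φ multiplies all
heights by the same constant. -/
theorem ballFactor_busemann {φ : ClosedBall n ≃ₜ ClosedBall n} (hφ : φ ∈ HypIsom n)
    (hfix : φ (south n) = south n) {v w : ClosedBall n} (hv : v ∈ inner n) (hw : w ∈ inner n) :
    cayley (φ v : E n) 0 * cayley (w : E n) 0 = cayley (v : E n) 0 * cayley (φ w : E n) 0 := by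
  -- Taking the ratio of the two distance identities eliminates the factors at u and φ u, which
  -- vanish on the sphere; what is left is continuous in u and extends from the dense open ball.
  have key : ∀ u : ClosedBall n, ‖(φ u : E n) - φ v‖ ^ 2 * ‖(u : E n) - w‖ ^ 2 *
      (ballFactor (v : E n) * ballFactor (φ w : E n)) =
      ‖(φ u : E n) - φ w‖ ^ 2 * ‖(u : E n) - v‖ ^ 2 *
      (ballFactor (w : E n) * ballFactor (φ v : E n)) := by
    intro u
    have hcont : ∀ x y : ClosedBall n, ∀ c : ℝ, Continuous fun u : ClosedBall n =>
        ‖(φ u : E n) - x‖ ^ 2 * ‖(u : E n) - y‖ ^ 2 * c := fun x y c => by fun_prop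
    refine congrFun (Continuous.ext_on (dense_inner n) (hcont _ _ _) (hcont _ _ _) ?_) u
    · intro u hu
      have h1 := norm_sub_sq_of_mem_hypIsom hφ hu hv
      have h2 := norm_sub_sq_of_mem_hypIsom hφ hu hw
      have p1 := ballFactor_pos hu
      have p2 := ballFactor_pos hv
      have p3 := ballFactor_pos hw
      refine mul_left_cancel₀ p1.ne' ?_
      refine mul_left_cancel₀ p3.ne' ?_
      refine mul_left_cancel₀ p2.ne' ?_
      linear_combination (ballFactor (v : E n) * ‖(u : E n) - w‖ ^ 2 * ballFactor (φ w : E n) * ballFactor (w : E n)) * h1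
        - (ballFactor (v : E n) * ‖(u : E n) - v‖ ^ 2 * ballFactor (φ v : E n) * ballFactor (w : E n)) * h2
  have h := key (south n)
  rw [hfix] at h
  have hn : ∀ x : ClosedBall n, ‖((south n : ClosedBall n) : E n) - x‖ = ‖(x : E n) + e0 n‖ :=
    fun x => by
      rw [← norm_neg]
      congr 1
      simp [south]
  simp only [hn] at h
  have c1 := ne_neg_e0_of_norm_lt hv
  have c2 := ne_neg_e0_of_norm_lt hw
  have c3 := ne_neg_e0_of_norm_lt ((hφ.1 v).2 hv)
  have c4 := ne_neg_e0_of_norm_lt ((hφ.1 w).2 hw)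
  rw [cayley_apply_zero c1, cayley_apply_zero c2, cayley_apply_zero c3, cayley_apply_zero c4]
  have := norm_add_e0_pos c1
  have := norm_add_e0_pos c2
  have := norm_add_e0_pos c3
  have := norm_add_e0_pos c4
  field_simp
  linarith

theorem continuousOn_cayley_coe :
    ContinuousOn (fun w : ClosedBall n => cayley (w : E n)) {south n}ᶜ := fun _ hw =>
  ((continuousAt_cayley (ne_neg_e0_of_ne_south hw)).comp
    continuous_subtype_val.continuousAt).continuousWithinAt

/-- An isometry of hyperbolic space that fixes the point at infinity of the upper half-space
acts on the closed half-space as a Euclidean similarity. -/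
theorem exists_similarity {φ : ClosedBall n ≃ₜ ClosedBall n} (hφ : φ ∈ HypIsom n)
    (hfix : φ (south n) = south n) :
    ∃ (A : E n ≃ₗᵢ[ℝ] E n) (b : E n) (l : ℝ), 0 < l ∧ (∀ X : E n, (b + l • A X) 0 = l * X 0) ∧
      ∀ w, w ≠ south n → cayley (φ w : E n) = b + l • A (cayley (w : E n)) := by
  have ho : origin n ∈ inner n := by simp [origin, inner]
  have hpos : ∀ v ∈ inner n, 0 < cayley (v : E n) 0 := fun v hv => cayley_apply_zero_pos hv
  set l := cayley (φ (origin n) : E n) 0 / cayley (origin n : E n) 0 with hl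
  have hlpos : 0 < l := div_pos (hpos _ ((hφ.1 _).2 ho)) (hpos _ ho)
  have h0 : ∀ v ∈ inner n, cayley (φ v : E n) 0 = l * cayley (v : E n) 0 := fun v hv => by
    have h1 := ballFactor_busemann hφ hfix hv ho
    have h2 := hpos _ ho
    rw [hl]
    field_simp
    linarith
  -- Half-space distance depends only on the squared Euclidean distance over the product of heights;
  -- heights scale by l, so Euclidean distances do too.
  have hd : ∀ v ∈ inner n, ∀ w ∈ inner n, ‖cayley (φ v : E n) - cayley (φ w : E n)‖ =
      l * ‖cayley (v : E n) - cayley (w : E n)‖ := by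
    intro v hv w hw
    have h1 := norm_sub_sq_of_mem_hypIsom hφ hv hw
    have c1 := ne_neg_e0_of_norm_lt hv
    have c2 := ne_neg_e0_of_norm_lt hw
    have c3 := ne_neg_e0_of_norm_lt ((hφ.1 v).2 hv)
    have c4 := ne_neg_e0_of_norm_lt ((hφ.1 w).2 hw)
    have hv0 := h0 v hv
    have hw0 := h0 w hw
    rw [cayley_apply_zero c1, cayley_apply_zero c3] at hv0
    rw [cayley_apply_zero c2, cayley_apply_zero c4] at hw0
    have p1 := norm_add_e0_pos c1
    have p2 := norm_add_e0_pos c2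
    have p3 := norm_add_e0_pos c3
    have p4 := norm_add_e0_pos c4
    have q1 := ballFactor_pos hv
    have q2 := ballFactor_pos hw
    rw [← sq_eq_sq₀ (norm_nonneg _) (by positivity), mul_pow, norm_cayley_sub_sq c3 c4,
      norm_cayley_sub_sq c1 c2]
    field_simp at hv0 hw0 ⊢
    refine mul_right_cancel₀ (mul_pos q1 q2).ne' ?_
    calc _ = (‖(φ v : E n) - φ w‖ ^ 2 * (ballFactor (v : E n) * ballFactor (w : E n))) *
          (‖(v : E n) + e0 n‖ ^ 2 * ‖(w : E n) + e0 n‖ ^ 2) := by ring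
      _ = ‖(v : E n) - w‖ ^ 2 * (‖(v : E n) + e0 n‖ ^ 2 * ballFactor (φ v : E n)) *
          (‖(w : E n) + e0 n‖ ^ 2 * ballFactor (φ w : E n)) := by rw [h1]; ring
      _ = _ := by rw [mul_comm (‖(v : E n) + e0 n‖ ^ 2), hv0, mul_comm (‖(w : E n) + e0 n‖ ^ 2), hw0]; ring
  let S : Set (E n) := {X | 0 < X 0}
  let lft : ∀ X : E n, X ∈ S → ClosedBall n := fun X hX =>
    ⟨cayley X, by simpa using (norm_cayley_lt_one hX).le⟩
  have hlft : ∀ X (hX : X ∈ S), lft X hX ∈ inner n := fun X hX => norm_cayley_lt_one hX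
  have hclft : ∀ X (hX : X ∈ S), cayley (lft X hX : E n) = X := fun X hX =>
    cayley_cayley (ne_neg_e0_of_nonneg (le_of_lt hX))
  classical
  let T : E n → E n := fun X => if hX : X ∈ S then cayley (φ (lft X hX) : E n) else 0
  have hT : ∀ x ∈ S, ∀ y ∈ S, ‖T x - T y‖ = l * ‖x - y‖ := fun x hx y hy => by
    have := hd _ (hlft x hx) _ (hlft y hy)
    rw [hclft x hx, hclft y hy] at this
    simpa [T, hx, hy] using this
  have he : e0 n ∈ S := by simp [S, e0_apply_zero]
  obtain ⟨A, hA⟩ := exists_linearIsometry_of_norm_sub (S := S) (T := T) (b := e0 n) hlpos one_pos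
    he (fun i => by
      by_cases h : i = 0
      · subst h; simp [S, e0_apply_zero]
      · simp [S, e0_apply_zero, Ne.symm h]) hT
  set b := T (e0 n) - l • A (e0 n) with hb
  have hA' : ∀ X ∈ S, T X = b + l • A X := fun X hX => by
    rw [hA X hX, hb, map_sub, smul_sub]
    abel
  have hin : ∀ w ∈ inner n, cayley (φ w : E n) = b + l • A (cayley (w : E n)) := fun w hw => by
    have hm : cayley (w : E n) ∈ S := hpos w hw
    rw [← hA' _ hm]
    have : lft _ hm = w := Subtype.ext (cayley_cayley (ne_neg_e0_of_norm_lt hw))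
    simp [T, hm, this]
  have hS : ∀ X ∈ S, (b + l • A X) 0 = l * X 0 := fun X hX => by
    have h1 := hin _ (hlft X hX)
    have h2 := h0 _ (hlft X hX)
    rw [h1, hclft X hX] at h2
    exact h2
  refine ⟨A, b, l, hlpos, fun X => ?_, fun w hw => ?_⟩
  -- Any X equals 2M - Y with Y and M = (X + Y)/2 in the open half-space, so the affine identity
  -- known there holds everywhere.
  · let Y : E n := (|X 0| + 1) • e0 n
    have hY : Y ∈ S := by
      simp [Y, S, e0_apply_zero]; positivity
    have hM : (1 / 2 : ℝ) • (X + Y) ∈ S := by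
      simp [Y, S, e0_apply_zero]
      linarith [neg_abs_le (X 0)]
    have h1 := hS Y hY
    have h2 := hS _ hM
    simp [map_add, map_smul] at h1 h2 ⊢
    linarith
  · have hφs : Set.MapsTo φ {south n}ᶜ {south n}ᶜ := fun v hv h =>
      hv (φ.injective ((show φ v = south n from h).trans hfix.symm))
    -- The formula passes by continuity from the open ball to the sphere without the south pole,
    -- where the inversion is continuous.
    refine Set.EqOn.of_subset_closure (s := inner n) (t := {south n}ᶜ)
      (f := fun w => cayley (φ w : E n)) (g := fun w => b + l • A (cayley (w : E n)))
      (fun w hw => hin w hw) (continuousOn_cayley_coe.comp φ.continuous.continuousOn hφs) ?_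
      (fun v hv => ne_south_of_mem_inner hv) (fun v _ => dense_inner n v) hw
    exact continuousOn_const.add
      ((A.continuous.comp_continuousOn continuousOn_cayley_coe).const_smul l)

end

/-! ### Isometries as smooth maps, and truncated norms in the half-space -/

section

variable {n : ℕ} [NeZero n]

theorem mem_inner_or_sphere {n : ℕ} (w : ClosedBall n) :
    w ∈ inner n ∨ w ∈ sphereAtInfinity n :=
  lt_or_eq_of_le (mem_closedBall_zero_iff.1 w.2)

/-- Two vectors of equal norm are exchanged by the reflection in their bisecting hyperplane. -/
theorem exists_linearIsometry_south {ξ : ClosedBall n} (h : ξ ∈ sphereAtInfinity n) :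
    ∃ A : E n ≃ₗᵢ[ℝ] E n, linHomeo A ξ = south n := by
  have h' : ‖(ξ : E n)‖ = ‖-e0 n‖ := by
    rw [norm_neg, norm_e0]; exact h
  exact ⟨Submodule.reflection (ℝ ∙ ((ξ : E n) - -e0 n))ᗮ,
    Subtype.ext (Submodule.reflection_sub h')⟩

/-- Isometries of hyperbolic space are the restrictions of smooth maps that intertwine the
hyperbolic Laplacian with itself. -/
theorem exists_laplaceEquivariant {φ : ClosedBall n ≃ₜ ClosedBall n} (hφ : φ ∈ HypIsom n) :
    ∃ Φ : E n → E n, ∀ w ∈ inner n, Φ w = φ w ∧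
      LaplaceEquivariantAt ballFactor ballFactor Φ (w : E n) := by
  have hs : φ (south n) ∈ sphereAtInfinity n := by
    refine (mem_inner_or_sphere _).resolve_left fun h => ?_
    exact ne_south_of_mem_inner ((hφ.1 _).1 h) rfl
  -- Composing with a linear isometry makes the map fix the south pole, so that it becomes a
  -- similarity in the half-space.
  obtain ⟨R, hR⟩ := exists_linearIsometry_south hs
  have hψ : linHomeo R * φ ∈ HypIsom n := (HypIsom n).mul_mem (linHomeo_mem R) hφ
  obtain ⟨A, b, l, hl, h0, h⟩ := exists_similarity hψ hR
  refine ⟨R.symm ∘ cayley ∘ (fun X => b + l • A X) ∘ cayley, fun w hw => ?_⟩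
  have h1 := h w (ne_south_of_mem_inner hw)
  have hc : ((linHomeo R * φ) w : E n) = R (φ w) := rfl
  have hRw : ‖R (φ w : E n)‖ < 1 := by
    rw [R.norm_map]; exact (hφ.1 w).2 hw
  have hpos : 0 < (b + l • A (cayley (w : E n))) 0 := by
    rw [h0]; exact mul_pos hl (cayley_apply_zero_pos hw)
  rw [hc] at h1
  constructor
  · simp only [Function.comp_apply, ← h1]
    rw [cayley_cayley (ne_neg_e0_of_norm_lt hRw), LinearIsometryEquiv.symm_apply_apply]
  · refine (laplaceEquivariantAt_linearIsometry R.symm _).comp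
      (LaplaceEquivariantAt.comp (d₂ := fun y => y 0) (laplaceEquivariantAt_cayley_halfSpace
        (ne_neg_e0_of_nonneg hpos.le)) (LaplaceEquivariantAt.comp (d₂ := fun y => y 0) ?_
        (laplaceEquivariantAt_cayley_ball (ne_neg_e0_of_norm_lt hw))))
    exact laplaceEquivariantAt_similarity A b l (differentiableAt_apply _ _)
      (differentiableAt_apply _ _) h0

theorem confLap_ballFactor_eq {n : ℕ} {d u v : E n → ℝ} {Φ : E n → E n} {w : E n}
    (hΦ : LaplaceEquivariantAt ballFactor d Φ w) (hu : ContDiffAt ℝ 2 u (Φ w))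
    (h : v =ᶠ[𝓝 w] u ∘ Φ) :
    ContDiffAt ℝ 2 v w ∧ confLap ballFactor v w = confLap d u (Φ w) := by
  refine ⟨(ContDiffAt.comp w hu hΦ.contDiffAt).congr_of_eventuallyEq h, ?_⟩
  rw [confLap_congr h, hΦ.confLap_comp u hu]

theorem ofHalfSpace_mem {X : E n} (hX : 0 ≤ X 0) : cayley X ∈ Metric.closedBall (0 : E n) 1 := by
  have h := ballFactor_cayley (ne_neg_e0_of_nonneg hX)
  have : 0 ≤ ballFactor (cayley X) := by rw [h]; positivity
  unfold ballFactor at this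
  rw [mem_closedBall_zero_iff]
  nlinarith [norm_nonneg (cayley X)]

theorem cayley_apply_zero_nonneg {w : ClosedBall n} (h : w ≠ south n) :
    0 ≤ cayley (w : E n) 0 := by
  rw [cayley_apply_zero (ne_neg_e0_of_ne_south h)]
  have : ‖(w : E n)‖ ≤ 1 := mem_closedBall_zero_iff.1 w.2
  have : 0 ≤ ballFactor (w : E n) := by
    unfold ballFactor
    nlinarith [norm_nonneg (w : E n)]
  positivity

/-- The orthogonal projection to the coordinates with index less than `k`. -/
noncomputable def trunc {n : ℕ} (k : ℕ) (X : E n) : E n :=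
  WithLp.toLp 2 fun i => if i.val < k then X i else 0

theorem norm_trunc_sq {n : ℕ} (k : ℕ) (X : E n) :
    ‖trunc k X‖ ^ 2 = ∑ i : Fin n with i.val < k, X i ^ 2 := by
  rw [EuclideanSpace.real_norm_sq_eq, Finset.sum_filter]
  refine Finset.sum_congr rfl fun i _ => ?_
  by_cases h : i.val < k <;> simp [trunc, h]

theorem norm_trunc_le {n : ℕ} (k : ℕ) (X : E n) : ‖trunc k X‖ ≤ ‖X‖ := by
  rw [← sq_le_sq₀ (norm_nonneg _) (norm_nonneg _), norm_trunc_sq, EuclideanSpace.real_norm_sq_eq]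
  exact Finset.sum_le_univ_sum_of_nonneg fun i => sq_nonneg _

theorem trunc_add {n : ℕ} (k : ℕ) (X Y : E n) : trunc k (X + Y) = trunc k X + trunc k Y := by
  ext i
  by_cases h : i.val < k <;> simp [trunc, h]

theorem sq_apply_zero_le_norm_trunc_sq {k : ℕ} (hk : 0 < k) (X : E n) :
    X 0 ^ 2 ≤ ‖trunc k X‖ ^ 2 := by
  rw [norm_trunc_sq]
  exact Finset.single_le_sum (f := fun i => X i ^ 2) (fun i _ => sq_nonneg _) (by simpa using hk)

/-- If `|V - W|² ≤ C V₀ W₀`, that is, if two points of the half-space are at bounded distance, then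
the norms of their truncations are comparable. -/
theorem norm_trunc_le_of_norm_sub_le {k : ℕ} (hk : 0 < k) {V W : E n} {C : ℝ} (hC : 0 ≤ C)
    (hV : 0 ≤ V 0) (hW : 0 ≤ W 0) (h : ‖W - V‖ ^ 2 ≤ C * (V 0 * W 0)) :
    ‖trunc k W‖ ≤ (2 + C) * ‖trunc k V‖ := by
  have h1 : V 0 ≤ ‖trunc k V‖ := by
    rw [← sq_le_sq₀ hV (norm_nonneg _)]; exact sq_apply_zero_le_norm_trunc_sq hk V
  have h2 : W 0 ≤ ‖trunc k W‖ := by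
    rw [← sq_le_sq₀ hW (norm_nonneg _)]; exact sq_apply_zero_le_norm_trunc_sq hk W
  have h3 : ‖trunc k W‖ ≤ ‖trunc k V‖ + ‖W - V‖ := by
    calc _ = ‖trunc k V + trunc k (W - V)‖ := by rw [← trunc_add, add_sub_cancel]
      _ ≤ _ := (norm_add_le _ _).trans (by gcongr; exact norm_trunc_le _ _)
  have h4 : ‖W - V‖ ^ 2 ≤ C * (‖trunc k V‖ * ‖trunc k W‖) := h.trans (by gcongr)
  -- The arithmetic-geometric mean inequality; the half of |trunc W| on the right is absorbed in the
  -- final line, which is why the constant is 2 + C.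
  have h5 : ‖W - V‖ ≤ (C * ‖trunc k V‖ + ‖trunc k W‖) / 2 := by
    refine abs_le_of_sq_le_sq' ?_ (by positivity) |>.2
    nlinarith [sq_nonneg (C * ‖trunc k V‖ - ‖trunc k W‖)]
  linarith

end

/-! ### Geometry of a single cusp -/

namespace Cusp

variable {n : ℕ} [NeZero n] {Γ : Subgroup (ClosedBall n ≃ₜ ClosedBall n)} (c : Cusp Γ)

theorem chart_symm_mem : c.chart.symm ∈ HypIsom n := (HypIsom n).inv_mem c.chart_isom

theorem chart_symm_p : c.chart.symm c.p = south n := Subtype.ext c.chart_p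

theorem chart_south : c.chart (south n) = c.p := by rw [← c.chart_symm_p, Homeomorph.apply_symm_apply]

theorem chart_symm_ne {w : ClosedBall n} (hw : w ≠ c.p) : c.chart.symm w ≠ south n := fun h =>
  hw (c.chart.symm.injective (h.trans c.chart_symm_p.symm))

theorem p_not_mem_inner : c.p ∉ inner n := fun h =>
  ne_south_of_mem_inner ((c.chart_symm_mem.1 c.p).2 h) c.chart_symm_p

theorem ne_p_of_mem_inner {w : ClosedBall n} (hw : w ∈ inner n) : w ≠ c.p := by
  rintro rfl
  exact c.p_not_mem_inner hw

theorem coord_zero_nonneg {w : ClosedBall n} (hw : w ≠ c.p) : 0 ≤ c.coord w 0 :=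
  cayley_apply_zero_nonneg (c.chart_symm_ne hw)

theorem coord_zero_pos {w : ClosedBall n} (hw : w ∈ inner n) : 0 < c.coord w 0 :=
  cayley_apply_zero_pos ((c.chart_symm_mem.1 w).2 hw)

theorem normSq_eq (w : ClosedBall n) : c.normSq w = ‖trunc (n - c.rank) (c.coord w)‖ ^ 2 :=
  (norm_trunc_sq _ _).symm

theorem codim_pos : 0 < n - c.rank := by
  have := c.rank_le
  have := NeZero.pos n
  omega

/-- The point of the closed half-space with given coordinates. -/
noncomputable def ofCoord (X : E n) (hX : 0 ≤ X 0) : ClosedBall n := c.chart ⟨cayley X, ofHalfSpace_mem hX⟩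

theorem coord_ofCoord {X : E n} (hX : 0 ≤ X 0) : c.coord (c.ofCoord X hX) = X := by
  unfold coord ofCoord
  rw [Homeomorph.symm_apply_apply]
  exact cayley_cayley (ne_neg_e0_of_nonneg hX)

theorem ofCoord_ne {X : E n} (hX : 0 ≤ X 0) : c.ofCoord X hX ≠ c.p := fun h => by
  rw [← c.chart_south] at h
  exact cayley_ne (ne_neg_e0_of_nonneg hX) (congrArg Subtype.val (c.chart.injective h))

theorem ofCoord_mem_inner {X : E n} (hX : 0 < X 0) : c.ofCoord X hX.le ∈ inner n :=
  (c.chart_isom.1 _).2 (norm_cayley_lt_one hX)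

/-- The chart is an isometry, so both sides encode the same hyperbolic distance, in ball and in
half-space form. -/
theorem norm_coord_sub_sq {v w : ClosedBall n} (hv : v ∈ inner n) (hw : w ∈ inner n) :
    ‖c.coord v - c.coord w‖ ^ 2 * (ballFactor (v : E n) * ballFactor (w : E n)) =
      ‖(v : E n) - w‖ ^ 2 * (c.coord v 0 * c.coord w 0) := by
  have h := norm_sub_sq_of_mem_hypIsom c.chart_symm_mem hv hw
  have hv' := (c.chart_symm_mem.1 v).2 hv
  have hw' := (c.chart_symm_mem.1 w).2 hw
  have c1 := ne_neg_e0_of_norm_lt hv'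
  have c2 := ne_neg_e0_of_norm_lt hw'
  have p1 := norm_add_e0_pos c1
  have p2 := norm_add_e0_pos c2
  unfold coord
  rw [cayley_apply_zero c1, cayley_apply_zero c2, norm_cayley_sub_sq c1 c2]
  field_simp
  linear_combination 4 * h

theorem exists_laplaceEquivariant_coord : ∃ Φ : E n → E n, ∀ w ∈ inner n, Φ w = c.coord w ∧
    LaplaceEquivariantAt ballFactor (fun y => y 0) Φ (w : E n) := by
  obtain ⟨Φ, hΦ⟩ := exists_laplaceEquivariant c.chart_symm_mem
  refine ⟨cayley ∘ Φ, fun w hw => ?_⟩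
  obtain ⟨h1, h2⟩ := hΦ w hw
  refine ⟨by simp [h1, coord], LaplaceEquivariantAt.comp (laplaceEquivariantAt_cayley_ball ?_) h2⟩
  rw [h1]
  exact ne_neg_e0_of_norm_lt ((c.chart_symm_mem.1 w).2 hw)

/-- The coordinates are on the subspace `ℝ^f` of the horosphere `{x = 1}`. -/
def IsFlat (X : E n) : Prop :=
  X 0 = 1 ∧ ∀ i : Fin n, 0 < i.val → i.val < n - c.rank → X i = 0

/-- The point of `ℝ^f` nearest to `X`. -/
noncomputable def nearest (X : E n) : E n := X - trunc (n - c.rank) X + e0 n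

theorem isFlat_nearest (X : E n) : c.IsFlat (c.nearest X) := by
  have hk := c.codim_pos
  refine ⟨?_, fun i hi hik => ?_⟩
  · simp [nearest, trunc, hk, e0_apply_zero]
  · have : i ≠ 0 := fun h => by simp [h] at hi
    simp [nearest, trunc, hik, e0, this]

theorem norm_sub_nearest_sq (X : E n) :
    ‖X - c.nearest X‖ ^ 2 = ‖trunc (n - c.rank) X‖ ^ 2 - 2 * X 0 + 1 := by
  have h : X - c.nearest X = trunc (n - c.rank) X - e0 n := by simp [nearest]; abel
  rw [h, norm_sub_sq_real, norm_e0]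
  simp [e0, EuclideanSpace.inner_single_right, trunc, c.codim_pos]

/-- On the first n - f coordinates a flat point agrees with e₀, and dropping the others only
shortens the vector. With `norm_sub_nearest_sq` this shows that s - 2x + 1 is the squared distance
from X to the flat. -/
theorem le_norm_sub_sq_of_isFlat (X : E n) {Y : E n} (hY : c.IsFlat Y) :
    ‖trunc (n - c.rank) X‖ ^ 2 - 2 * X 0 + 1 ≤ ‖X - Y‖ ^ 2 := by
  have h : trunc (n - c.rank) (X - Y) = trunc (n - c.rank) X - e0 n := by
    ext i
    by_cases hi : i.val < n - c.rank
    · by_cases h0 : i = 0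
      · subst h0
        have : c.rank < n := Nat.lt_of_sub_pos hi
        simp [trunc, this, hY.1, e0_apply_zero]
      · have : 0 < i.val := Nat.pos_of_ne_zero fun h => h0 (Fin.ext h)
        simp [trunc, hi, hY.2 i this hi, e0, h0]
    · have h0 : i ≠ 0 := by
        rintro rfl
        exact hi (by simpa using c.codim_pos)
      simp [trunc, hi, e0, h0]
  calc _ = ‖trunc (n - c.rank) (X - Y)‖ ^ 2 := by
        rw [h, norm_sub_sq_real, norm_e0]
        simp [e0, EuclideanSpace.inner_single_right, trunc, c.codim_pos]
    _ ≤ _ := by gcongr; exact norm_trunc_le _ _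

/-- The stabilizer of a cusp acts by Euclidean isometries in the upper half-space coordinates. -/
theorem exists_isometry (hΓ : Γ ≤ HypIsom n) {γ : ClosedBall n ≃ₜ ClosedBall n}
    (hγ : γ ∈ stab Γ c.p) : ∃ (A : E n ≃ₗᵢ[ℝ] E n) (b : E n),
      (∀ X : E n, (b + A X) 0 = X 0) ∧ ∀ w, w ≠ c.p → c.coord (γ w) = b + A (c.coord w) := by
  have hψ : c.chart.symm * γ * c.chart ∈ HypIsom n :=
    (HypIsom n).mul_mem ((HypIsom n).mul_mem c.chart_symm_mem (hΓ hγ.1)) c.chart_isom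
  have hfix : (c.chart.symm * γ * c.chart) (south n) = south n := by
    change c.chart.symm (γ (c.chart (south n))) = _
    rw [c.chart_south, hγ.2, c.chart_symm_p]
  obtain ⟨A, b, l, hl, h0, h⟩ := exists_similarity hψ hfix
  have h1 : ∀ w, w ≠ c.p → c.coord (γ w) = b + l • A (c.coord w) := fun w hw => by
    have := h _ (c.chart_symm_ne hw)
    change cayley (c.chart.symm (γ (c.chart (c.chart.symm w))) : E n) = _ at this
    rwa [Homeomorph.apply_symm_apply] at this
  -- The flat lies at height 1 and is preserved, while the similarity multiplies heights by l.
  have hl1 : l = 1 := by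
    have hf := c.isFlat_nearest 0
    have hX : (0 : ℝ) ≤ c.nearest 0 0 := by rw [hf.1]; norm_num
    have hq := c.coord_ofCoord hX
    have h2 := (c.invariant γ hγ (c.ofCoord _ hX) (c.ofCoord_ne hX)
      (by rw [← hq] at hf; exact hf)).1
    change c.coord (γ _) 0 = 1 at h2
    rw [h1 _ (c.ofCoord_ne hX), h0, hq, hf.1, mul_one] at h2
    exact h2
  subst hl1
  simp only [one_smul, one_mul] at h0 h1
  exact ⟨A, b, h0, h1⟩

theorem apply_ne_p {γ : ClosedBall n ≃ₜ ClosedBall n} (hγ : γ ∈ stab Γ c.p) {w : ClosedBall n}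
    (hw : w ≠ c.p) : γ w ≠ c.p := fun h => hw (γ.injective (h.trans hγ.2.symm))

/-- A stabilizer element is a Euclidean isometry that preserves the height x and the flat, hence the
squared distance s - 2x + 1 to the flat, hence s. One inequality suffices, applied to γ and to γ⁻¹.
-/
theorem normSq_stab (hΓ : Γ ≤ HypIsom n) {γ : ClosedBall n ≃ₜ ClosedBall n}
    (hγ : γ ∈ stab Γ c.p) {w : ClosedBall n} (hw : w ≠ c.p) : c.normSq (γ w) = c.normSq w := by
  have key : ∀ γ ∈ stab Γ c.p, ∀ w, w ≠ c.p → c.normSq (γ w) ≤ c.normSq w := by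
    intro γ hγ w hw
    obtain ⟨A, b, h0, h⟩ := c.exists_isometry hΓ hγ
    have hf := c.isFlat_nearest (c.coord w)
    have hX : (0 : ℝ) ≤ c.nearest (c.coord w) 0 := by rw [hf.1]; norm_num
    have hq := c.coord_ofCoord hX
    have h2 : c.IsFlat (c.coord (γ (c.ofCoord _ hX))) :=
      c.invariant γ hγ (c.ofCoord _ hX) (c.ofCoord_ne hX) (by rw [← hq] at hf; exact hf)
    have h3 := c.le_norm_sub_sq_of_isFlat (c.coord (γ w)) h2
    rw [h _ (c.ofCoord_ne hX), hq, h w hw, add_sub_add_left_eq_sub, ← map_sub,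
      LinearIsometryEquiv.norm_map, c.norm_sub_nearest_sq, h0] at h3
    rw [c.normSq_eq, c.normSq_eq, h w hw]
    linarith
  refine le_antisymm (key γ hγ w hw) ?_
  have h4 := key γ⁻¹ ((stab Γ c.p).inv_mem hγ) (γ w) (c.apply_ne_p hγ hw)
  have h5 : γ⁻¹ (γ w) = w := γ.symm_apply_apply w
  rwa [h5] at h4

/-- Cocompactness moves the nearest flat point to a bounded set, and w stays within √(R' + 1) of it
because x ≥ 0. -/
theorem exists_stab_norm_coord_le (hΓ : Γ ≤ HypIsom n) (R' : ℝ) : ∃ B : ℝ, ∀ w, w ≠ c.p →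
    c.normSq w ≤ R' → ∃ γ ∈ stab Γ c.p, ‖c.coord (γ w)‖ ≤ B := by
  obtain ⟨B, hB⟩ := c.cocompact
  refine ⟨B + √(R' + 1), fun w hw hR => ?_⟩
  have hf := c.isFlat_nearest (c.coord w)
  have hX : (0 : ℝ) ≤ c.nearest (c.coord w) 0 := by rw [hf.1]; norm_num
  have hq := c.coord_ofCoord hX
  obtain ⟨γ, hγ, h1⟩ := hB (c.ofCoord _ hX) (c.ofCoord_ne hX) (by rw [← hq] at hf; exact hf)
  change ‖c.coord (γ _)‖ ≤ B at h1
  obtain ⟨A, b, h0, h⟩ := c.exists_isometry hΓ hγ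
  refine ⟨γ, hγ, ?_⟩
  rw [h _ (c.ofCoord_ne hX), hq] at h1
  have h2 : ‖c.coord w - c.nearest (c.coord w)‖ ≤ √(R' + 1) := by
    apply Real.le_sqrt_of_sq_le
    rw [c.norm_sub_nearest_sq, ← c.normSq_eq]
    linarith [c.coord_zero_nonneg hw]
  calc ‖c.coord (γ w)‖ = ‖(b + A (c.nearest (c.coord w))) +
        A (c.coord w - c.nearest (c.coord w))‖ := by
        rw [h w hw, map_sub]
        congr 1
        abel
    _ ≤ _ := (norm_add_le _ _).trans (add_le_add h1 (by rwa [LinearIsometryEquiv.norm_map]))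

/-- The part of a cusp region on which `x² + |y|²` is bounded is compact modulo the stabilizer. -/
theorem exists_isCompact_subset_region (hΓ : Γ ≤ HypIsom n) (R R' : ℝ) :
    ∃ K : Set (ClosedBall n), IsCompact K ∧ K ⊆ c.region R ∧
      ∀ w ∈ c.region R, c.normSq w ≤ R' → ∃ γ ∈ stab Γ c.p, γ w ∈ K := by
  obtain ⟨B, hB⟩ := c.exists_stab_norm_coord_le hΓ R'
  -- Since the inversion turns |v + e₀| into 2/|v + e₀|, this is the set where |coordinates + e₀| ≤
  -- |B| + 1. It is closed in the ball and excludes the south pole, hence compact.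
  let K₁ : Set (ClosedBall n) := {v | 2 ≤ (|B| + 1) * ‖(v : E n) + e0 n‖}
  have hK₁ : IsClosed K₁ := isClosed_le continuous_const (by fun_prop)
  have hne : K₁ ⊆ {south n}ᶜ := by
    rintro v hv rfl
    simp [K₁, south] at hv
    linarith
  let F : Set (E n) := {X | R ≤ ∑ i : Fin n with i.val < n - c.rank, X i ^ 2}
  have hF : IsClosed F := isClosed_le continuous_const (by fun_prop)
  have hK : IsClosed (K₁ ∩ (fun v : ClosedBall n => cayley (v : E n)) ⁻¹' F) :=
    (continuousOn_cayley_coe.mono hne).preimage_isClosed_of_isClosed hK₁ hF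
  refine ⟨c.chart '' _, hK.isCompact.image c.chart.continuous, ?_, fun w hw hR => ?_⟩
  · rintro _ ⟨v, ⟨hv1, hv2⟩, rfl⟩
    refine ⟨fun h => hne hv1 ?_, ?_⟩
    · rw [← c.chart_south] at h
      exact c.chart.injective h
    · unfold normSq coord
      rw [Homeomorph.symm_apply_apply]
      exact hv2
  · obtain ⟨γ, hγ, h1⟩ := hB w hw.1 hR
    have hne' := c.apply_ne_p hγ hw.1
    refine ⟨γ, hγ, c.chart.symm (γ w), ⟨?_, ?_⟩, c.chart.apply_symm_apply _⟩
    · have h2 := ne_neg_e0_of_ne_south (c.chart_symm_ne hne')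
      have h3 := norm_cayley_add_e0 h2
      have h4 := norm_add_e0_pos h2
      have h5 : ‖cayley (c.chart.symm (γ w) : E n) + e0 n‖ ≤ |B| + 1 := by
        refine (norm_add_le _ _).trans ?_
        rw [norm_e0]
        have : ‖c.coord (γ w)‖ ≤ |B| := h1.trans (le_abs_self B)
        exact add_le_add_left this 1
      rw [h3, div_le_iff₀ h4] at h5
      exact h5
    · change R ≤ c.normSq (γ w)
      rw [c.normSq_stab hΓ hγ hw.1]
      exact hw.2

end Cusp

/-! ### The quotients and their compact subsets -/

section

variable {n : ℕ} {Γ : Subgroup (ClosedBall n ≃ₜ ClosedBall n)}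

theorem isClosed_limitSet (Γ : Subgroup (ClosedBall n ≃ₜ ClosedBall n)) :
    IsClosed (limitSet Γ) := isClosed_derivedSet _

theorem apply_mem_limitSet {γ : ClosedBall n ≃ₜ ClosedBall n} (hγ : γ ∈ Γ) {w : ClosedBall n}
    (hw : w ∈ limitSet Γ) : γ w ∈ limitSet Γ := by
  have h : AccPt (γ w) (Filter.map γ (Filter.principal {w | ∃ γ ∈ Γ, w = γ (origin n)})) :=
    AccPt.map hw γ.continuous.continuousAt γ.injective
  refine h.mono ?_
  rw [Filter.map_principal, Filter.principal_mono]
  rintro _ ⟨_, ⟨τ, hτ, rfl⟩, rfl⟩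
  exact ⟨γ * τ, Γ.mul_mem hγ hτ, rfl⟩

theorem apply_mem_limitSet_iff {γ : ClosedBall n ≃ₜ ClosedBall n} (hγ : γ ∈ Γ) {w : ClosedBall n} :
    γ w ∈ limitSet Γ ↔ w ∈ limitSet Γ := by
  refine ⟨fun h => ?_, apply_mem_limitSet hγ⟩
  have := apply_mem_limitSet (Γ.inv_mem hγ) h
  rwa [show γ⁻¹ (γ w) = w from γ.symm_apply_apply w] at this

theorem apply_mem_innerOmega_iff (hΓ : Γ ≤ HypIsom n) {γ : ClosedBall n ≃ₜ ClosedBall n}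
    (hγ : γ ∈ Γ) {w : ClosedBall n} : γ w ∈ innerOmega Γ ↔ w ∈ innerOmega Γ := by
  have h1 := (hΓ hγ).1 w
  have h2 : γ w ∈ sphereAtInfinity n ↔ w ∈ sphereAtInfinity n := by
    have : ∀ v : ClosedBall n, v ∈ sphereAtInfinity n ↔ v ∉ inner n := fun v => by
      have := mem_closedBall_zero_iff.1 v.2
      simp only [sphereAtInfinity, inner, Set.mem_ofPred_eq, not_lt]
      exact ⟨fun h => h.ge, fun h => le_antisymm this h⟩
    rw [this, this, h1]
  simp only [innerOmega, Omega, Set.mem_union, Set.mem_sdiff, h1, h2, apply_mem_limitSet_iff hγ]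

/-- The saturation of an open set is the union of its translates. -/
theorem isOpenMap_mk_orbitSetoid {S : Set (ClosedBall n)}
    (hS : ∀ γ ∈ Γ, ∀ w, γ w ∈ S ↔ w ∈ S) :
    IsOpenMap (fun w : S => (Quotient.mk (orbitSetoid Γ S) w)) := by
  intro V hV
  obtain ⟨O, hO, rfl⟩ := isOpen_induced_iff.1 hV
  rw [← isQuotientMap_quotient_mk'.isOpen_preimage]
  have : (Quotient.mk (orbitSetoid Γ S)) ⁻¹' ((fun w : S => Quotient.mk (orbitSetoid Γ S) w) ''
      (Subtype.val ⁻¹' O)) = Subtype.val ⁻¹' ⋃ γ : Γ, (γ : ClosedBall n ≃ₜ ClosedBall n) ⁻¹' O := by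
    ext w
    simp only [Set.mem_preimage, Set.mem_image, Set.mem_iUnion]
    constructor
    · rintro ⟨v, hv, h⟩
      obtain ⟨γ, hγ, h⟩ := Quotient.exact h
      refine ⟨⟨γ⁻¹, Γ.inv_mem hγ⟩, ?_⟩
      change γ.symm w ∈ O
      rwa [← h, γ.symm_apply_apply]
    · rintro ⟨γ, hγ⟩
      refine ⟨⟨γ.1 w, (hS γ.1 γ.2 w).2 w.2⟩, hγ, Quotient.sound ⟨γ.1⁻¹, Γ.inv_mem γ.2, ?_⟩⟩
      exact γ.1.symm_apply_apply _
  exact this ▸ (isOpen_iUnion fun γ : Γ => hO.preimage γ.1.continuous).preimage continuous_subtype_val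

theorem isOpenMap_proj (hΓ : Γ ≤ HypIsom n) : IsOpenMap (proj Γ) :=
  isOpenMap_mk_orbitSetoid fun _ hγ w => (hΓ hγ).1 w

theorem isOpenMap_projBar (hΓ : Γ ≤ HypIsom n) : IsOpenMap (projBar Γ) :=
  isOpenMap_mk_orbitSetoid fun _ hγ _ => apply_mem_innerOmega_iff hΓ hγ

theorem projBar_eq_iff {v w : innerOmega Γ} :
    projBar Γ v = projBar Γ w ↔ ∃ γ ∈ Γ, γ v = (w : ClosedBall n) :=
  ⟨fun h => Quotient.exact h, fun h => Quotient.sound h⟩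

theorem proj_eq_iff {v w : inner n} : proj Γ v = proj Γ w ↔ ∃ γ ∈ Γ, γ v = (w : ClosedBall n) :=
  ⟨fun h => Quotient.exact h, fun h => Quotient.sound h⟩

theorem inner_subset_innerOmega : inner n ⊆ innerOmega Γ := Set.subset_union_left

/-- A compact subset of the quotient is covered by a ball of radius less than one. -/
theorem exists_radius_of_isCompact (hΓ : Γ ≤ HypIsom n) {Mc : Set (Mfd Γ)} (hMc : IsCompact Mc) :
    ∃ r < 1, ∀ w : inner n, proj Γ w ∈ Mc → ∃ γ ∈ Γ, ∃ v : inner n,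
      ‖((v : ClosedBall n) : E n)‖ ≤ r ∧ γ v = (w : ClosedBall n) := by
  let U : Set.Iio (1 : ℝ) → Set (Mfd Γ) := fun r =>
    proj Γ '' {v | ‖((v : ClosedBall n) : E n)‖ < r}
  obtain ⟨⟨r, hr⟩, h⟩ := hMc.elim_directed_cover U
    (fun r => isOpenMap_proj hΓ _ (isOpen_lt (by fun_prop) continuous_const))
    (fun m _ => by
      obtain ⟨v, rfl⟩ := Quotient.exists_rep m
      obtain ⟨r, h1, h2⟩ := exists_between (show ‖((v : ClosedBall n) : E n)‖ < 1 from v.2)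
      exact Set.mem_iUnion.2 ⟨⟨r, h2⟩, v, h1, rfl⟩)
    (Monotone.directed_le fun r r' hrr => Set.image_mono fun v hv =>
      (show ‖((v : ClosedBall n) : E n)‖ < r from hv).trans_le hrr)
  refine ⟨r, hr, fun w hw => ?_⟩
  obtain ⟨v, hv, hvw⟩ := h hw
  obtain ⟨γ, hγ, hγv⟩ := proj_eq_iff.1 hvw
  exact ⟨γ, hγ, v, le_of_lt hv, hγv⟩

theorem isCompact_image_proj {r : ℝ} (hr : r < 1) :
    IsCompact (proj Γ '' {v | ‖((v : ClosedBall n) : E n)‖ ≤ r}) := by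
  have hcont : Continuous (proj Γ) := continuous_quotient_mk'
  refine IsCompact.image ?_ hcont
  rw [Subtype.isCompact_iff]
  have : Subtype.val '' {v : inner n | ‖((v : ClosedBall n) : E n)‖ ≤ r} =
      {v : ClosedBall n | ‖(v : E n)‖ ≤ r} := by
    ext v
    constructor
    · rintro ⟨u, hu, rfl⟩
      exact hu
    · intro h
      exact ⟨⟨v, (show ‖(v : E n)‖ ≤ r from h).trans_lt hr⟩, h, rfl⟩
  rw [this]
  exact (isClosed_le (by fun_prop) continuous_const).isCompact

theorem lift_apply (u : MfdBar Γ → ℝ) (w : innerOmega Γ) :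
    lift Γ u ((w : ClosedBall n) : E n) = u (projBar Γ w) := by
  have h : ∃ w' : innerOmega Γ, ((w' : ClosedBall n) : E n) = ((w : ClosedBall n) : E n) := ⟨w, rfl⟩
  have : h.choose = w := Subtype.ext (Subtype.ext h.choose_spec)
  rw [lift, dif_pos h, this]

theorem lift_apply_inner (u : MfdBar Γ → ℝ) {w : ClosedBall n} (hw : w ∈ inner n) :
    lift Γ u (w : E n) = u (projBar Γ ⟨w, inner_subset_innerOmega hw⟩) := lift_apply u ⟨w, _⟩

theorem lift_invariant (hΓ : Γ ≤ HypIsom n) (u : MfdBar Γ → ℝ) {γ : ClosedBall n ≃ₜ ClosedBall n}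
    (hγ : γ ∈ Γ) {w : ClosedBall n} (hw : w ∈ inner n) :
    lift Γ u (γ w : E n) = lift Γ u (w : E n) := by
  rw [lift_apply_inner u hw, lift_apply_inner u (((hΓ hγ).1 w).2 hw)]
  congr 1
  exact (projBar_eq_iff.2 ⟨γ, hγ, rfl⟩).symm

theorem ball_subset_image_innerOmega :
    Metric.ball (0 : E n) 1 ⊆ Subtype.val '' innerOmega Γ := fun x hx =>
  ⟨⟨x, Metric.ball_subset_closedBall hx⟩,
    inner_subset_innerOmega (show ‖x‖ < 1 by simpa using hx), rfl⟩

theorem image_innerOmega_mem_nhds {x : E n} (hx : ‖x‖ < 1) :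
    Subtype.val '' innerOmega Γ ∈ 𝓝 x :=
  Filter.mem_of_superset (Metric.isOpen_ball.mem_nhds (by simpa using hx))
    ball_subset_image_innerOmega

end

/-! ### The weight on the ball and its invariance -/

section

variable {n : ℕ} [NeZero n] {Γ : Subgroup (ClosedBall n ≃ₜ ClosedBall n)} {nc : ℕ}
  {G : GeometricallyFinite Γ nc} (D : DefiningFunctions G)

/-- The logarithm of `sigmaPow` on the open ball. -/
noncomputable def logSigma (μ₀ : ℝ) (μ : Fin nc → ℝ) (x : E n) : ℝ :=
  μ₀ * Real.log (lift Γ D.ρ x) + ∑ j, μ j * Real.log (lift Γ (D.r j) x)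

theorem lift_ρ_pos {x : E n} (hx : ‖x‖ < 1) : 0 < lift Γ D.ρ x := by
  have hw : (⟨x, by simpa using hx.le⟩ : ClosedBall n) ∈ inner n := hx
  have := lift_apply_inner D.ρ hw
  rw [this]
  exact D.ρ_pos _ hw

theorem lift_r_pos (j : Fin nc) {w : ClosedBall n} (hw : w ∈ innerOmega Γ) :
    0 < lift Γ (D.r j) (w : E n) := by
  have := lift_apply (D.r j) ⟨w, hw⟩
  rw [this]
  exact D.r_pos _ _

theorem lift_r_pos_of_norm_lt (j : Fin nc) {x : E n} (hx : ‖x‖ < 1) : 0 < lift Γ (D.r j) x :=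
  lift_r_pos D j (w := ⟨x, by simpa using hx.le⟩) (inner_subset_innerOmega hx)

theorem sigmaPow_eq_exp (μ₀ : ℝ) (μ : Fin nc → ℝ) {x : E n} (hx : ‖x‖ < 1) :
    sigmaPow D μ₀ μ x = Real.exp (logSigma D μ₀ μ x) := by
  unfold sigmaPow logSigma
  rw [Real.exp_add, Real.exp_sum, Real.rpow_def_of_pos (lift_ρ_pos D hx), mul_comm μ₀]
  congr 1
  refine Finset.prod_congr rfl fun j _ => ?_
  rw [Real.rpow_def_of_pos (lift_r_pos_of_norm_lt D j hx), mul_comm]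

theorem eventually_norm_lt_one {n : ℕ} {x : E n} (hx : ‖x‖ < 1) : ∀ᶠ y in 𝓝 x, ‖y‖ < 1 :=
  continuous_norm.continuousAt.eventually (gt_mem_nhds hx)

theorem sigmaPow_eventuallyEq (μ₀ : ℝ) (μ : Fin nc → ℝ) {x : E n} (hx : ‖x‖ < 1) :
    sigmaPow D μ₀ μ =ᶠ[𝓝 x] fun y => Real.exp (logSigma D μ₀ μ y) :=
  (eventually_norm_lt_one hx).mono fun _ hy => sigmaPow_eq_exp D μ₀ μ hy

theorem contDiffAt_lift_ρ {x : E n} (hx : ‖x‖ < 1) : ContDiffAt ℝ ∞ (lift Γ D.ρ) x :=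
  D.ρ_smooth.contDiffAt (image_innerOmega_mem_nhds hx)

theorem contDiffAt_lift_r (j : Fin nc) {x : E n} (hx : ‖x‖ < 1) :
    ContDiffAt ℝ ∞ (lift Γ (D.r j)) x :=
  (D.r_smooth j).contDiffAt (image_innerOmega_mem_nhds hx)

theorem contDiffAt_logSigma (μ₀ : ℝ) (μ : Fin nc → ℝ) {x : E n} (hx : ‖x‖ < 1) :
    ContDiffAt ℝ ∞ (logSigma D μ₀ μ) x :=
  (contDiffAt_const.mul ((contDiffAt_lift_ρ D hx).log (lift_ρ_pos D hx).ne')).add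
    (ContDiffAt.sum fun j _ => contDiffAt_const.mul
      ((contDiffAt_lift_r D j hx).log (lift_r_pos_of_norm_lt D j hx).ne'))

theorem contDiffAt_sigmaPow (μ₀ : ℝ) (μ : Fin nc → ℝ) {x : E n} (hx : ‖x‖ < 1) :
    ContDiffAt ℝ 2 (sigmaPow D μ₀ μ) x :=
  ((contDiffAt_logSigma D μ₀ μ hx).exp.of_le (by norm_cast)).congr_of_eventuallyEq
    (sigmaPow_eventuallyEq D μ₀ μ hx)

theorem sigmaPow_pos (μ₀ : ℝ) (μ : Fin nc → ℝ) {x : E n} (hx : ‖x‖ < 1) :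
    0 < sigmaPow D μ₀ μ x := by
  rw [sigmaPow_eq_exp D μ₀ μ hx]
  exact Real.exp_pos _

theorem sigmaPow_invariant (μ₀ : ℝ) (μ : Fin nc → ℝ) {γ : ClosedBall n ≃ₜ ClosedBall n}
    (hγ : γ ∈ Γ) {w : ClosedBall n} (hw : w ∈ inner n) :
    sigmaPow D μ₀ μ (γ w : E n) = sigmaPow D μ₀ μ (w : E n) := by
  unfold sigmaPow
  simp_rw [lift_invariant G.kleinian.isom _ hγ hw]

/-- The weight is invariant and the deck transformations intertwine the Laplacian with itself; this
lets an estimate be checked at any representative of an orbit. -/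
theorem confLap_sigmaPow_invariant (μ₀ : ℝ) (μ : Fin nc → ℝ) {γ : ClosedBall n ≃ₜ ClosedBall n}
    (hγ : γ ∈ Γ) {w : ClosedBall n} (hw : w ∈ inner n) :
    confLap ballFactor (sigmaPow D μ₀ μ) (γ w : E n) =
      confLap ballFactor (sigmaPow D μ₀ μ) (w : E n) := by
  have hγ' := G.kleinian.isom hγ
  obtain ⟨Φ, hΦ⟩ := exists_laplaceEquivariant hγ'
  obtain ⟨h1, h2⟩ := hΦ w hw
  have h3 : sigmaPow D μ₀ μ =ᶠ[𝓝 (w : E n)] sigmaPow D μ₀ μ ∘ Φ := by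
    filter_upwards [eventually_norm_lt_one hw] with y hy
    have hy' : (⟨y, by simpa using hy.le⟩ : ClosedBall n) ∈ inner n := hy
    have h4 := sigmaPow_invariant D μ₀ μ hγ hy'
    rw [← (hΦ _ hy').1] at h4
    exact h4.symm
  have h5 := (confLap_ballFactor_eq h2 (h1 ▸ contDiffAt_sigmaPow D μ₀ μ ((hγ'.1 w).2 hw)) h3).2
  rw [h5, h1]

end

/-! ### The model weight in the half-space -/

/-- The logarithm of the model weight `x^a (x² + |y|²)^(-b)` of a cusp in the half-space, where
`(x, y)` are the first `k` coordinates. -/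
noncomputable def logModel (a b : ℝ) (k : ℕ) (X : E 4) : ℝ :=
  a * Real.log (X 0) - b * Real.log (∑ i : Fin 4 with i.val < k, X i ^ 2)

theorem hasFDerivAt_sum_sq (k : ℕ) (X : E 4) :
    HasFDerivAt (fun X : E 4 => ∑ i : Fin 4 with i.val < k, X i ^ 2)
      (∑ i : Fin 4 with i.val < k, (2 * X i) • (EuclideanSpace.proj i : E 4 →L[ℝ] ℝ)) X := by
  refine HasFDerivAt.fun_sum fun i _ => ?_
  have := ((EuclideanSpace.proj i : E 4 →L[ℝ] ℝ).hasFDerivAt (x := X)).pow 2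
  simpa using this

theorem sum_sq_apply_single (k : ℕ) (X : E 4) (i : Fin 4) :
    (∑ i : Fin 4 with i.val < k, (2 * X i) • (EuclideanSpace.proj i : E 4 →L[ℝ] ℝ))
      (EuclideanSpace.single i 1) = if i.val < k then 2 * X i else 0 := by
  rw [sum_apply, Finset.sum_filter, Finset.sum_eq_single i]
  · simp
  · intro j _ hj
    simp [hj]
  · simp

theorem sum_sq_pos {k : ℕ} (hk : 0 < k) {X : E 4} (hX : 0 < X 0) :
    0 < ∑ i : Fin 4 with i.val < k, X i ^ 2 := by
  rw [← norm_trunc_sq]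
  exact (pow_pos hX 2).trans_le (sq_apply_zero_le_norm_trunc_sq hk X)

theorem contDiffAt_logModel (a b : ℝ) {k : ℕ} (hk : 0 < k) {X : E 4} (hX : 0 < X 0) :
    ContDiffAt ℝ 2 (logModel a b k) X := by
  have hp : ∀ i : Fin 4, ContDiffAt ℝ 2 (fun X : E 4 => X i) X := fun i =>
    (EuclideanSpace.proj i : E 4 →L[ℝ] ℝ).contDiff.contDiffAt
  exact (contDiffAt_const.mul ((hp 0).log hX.ne')).sub (contDiffAt_const.mul
    ((ContDiffAt.sum fun i _ => (hp i).pow 2).log (sum_sq_pos hk hX).ne'))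

theorem pderiv_logModel (a b : ℝ) {k : ℕ} (hk : 0 < k) {X : E 4} (hX : 0 < X 0) (i : Fin 4) :
    pderiv i (logModel a b k) X = a * (if i = 0 then (X 0)⁻¹ else 0) -
      2 * b * (if i.val < k then X i * (∑ i : Fin 4 with i.val < k, X i ^ 2)⁻¹ else 0) := by
  have h0 : HasFDerivAt (fun X : E 4 => X 0) (EuclideanSpace.proj 0 : E 4 →L[ℝ] ℝ) X :=
    (EuclideanSpace.proj 0 : E 4 →L[ℝ] ℝ).hasFDerivAt
  have h := ((h0.log hX.ne').const_mul a).sub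
    (((hasFDerivAt_sum_sq k X).log (sum_sq_pos hk hX).ne').const_mul b)
  rw [pderiv, HasFDerivAt.fderiv (f := logModel a b k) h]
  simp only [sub_apply, smul_apply, sum_sq_apply_single, smul_eq_mul]
  have hp : (EuclideanSpace.proj 0 : E 4 →L[ℝ] ℝ) (EuclideanSpace.single i 1) =
      if i = 0 then 1 else 0 := by simp [eq_comm]
  rw [hp]
  split_ifs <;> ring

theorem pderiv_pderiv_logModel (a b : ℝ) {k : ℕ} (hk : 0 < k) {X : E 4} (hX : 0 < X 0)
    (i : Fin 4) :
    pderiv i (pderiv i (logModel a b k)) X = a * (if i = 0 then -((X 0) ^ 2)⁻¹ else 0) -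
      2 * b * (if i.val < k then (∑ i : Fin 4 with i.val < k, X i ^ 2)⁻¹ -
        2 * X i ^ 2 * ((∑ i : Fin 4 with i.val < k, X i ^ 2) ^ 2)⁻¹ else 0) := by
  set s : E 4 → ℝ := fun X => ∑ i : Fin 4 with i.val < k, X i ^ 2 with hs
  have hev : pderiv i (logModel a b k) =ᶠ[𝓝 X] fun X => a * (if i = 0 then (X 0)⁻¹ else 0) -
      2 * b * (if i.val < k then X i * (s X)⁻¹ else 0) := by
    have : ∀ᶠ Y : E 4 in 𝓝 X, 0 < Y 0 :=
      (by fun_prop : Continuous fun Y : E 4 => Y 0).continuousAt.eventually (lt_mem_nhds hX)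
    exact this.mono fun Y hY => pderiv_logModel a b hk hY i
  have hp : ∀ i : Fin 4, HasFDerivAt (fun X : E 4 => X i) (EuclideanSpace.proj i : E 4 →L[ℝ] ℝ) X :=
    fun i => (EuclideanSpace.proj i : E 4 →L[ℝ] ℝ).hasFDerivAt
  have h1 : HasFDerivAt (fun X : E 4 => (if i = 0 then (X 0)⁻¹ else 0))
      (if i = 0 then (-((X 0) ^ 2)⁻¹) • (EuclideanSpace.proj 0 : E 4 →L[ℝ] ℝ) else 0) X := by
    split_ifs
    · exact (hasDerivAt_inv hX.ne').comp_hasFDerivAt X (hp 0)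
    · exact hasFDerivAt_const _ _
  have hsX : s X ≠ 0 := (sum_sq_pos hk hX).ne'
  have h2 : HasFDerivAt (fun X : E 4 => (if i.val < k then X i * (s X)⁻¹ else 0))
      (if i.val < k then X i • ((-((s X) ^ 2)⁻¹) •
        (∑ i : Fin 4 with i.val < k, (2 * X i) • (EuclideanSpace.proj i : E 4 →L[ℝ] ℝ))) +
        (s X)⁻¹ • (EuclideanSpace.proj i : E 4 →L[ℝ] ℝ) else 0) X := by
    split_ifs
    · exact (hp i).mul ((hasDerivAt_inv hsX).comp_hasFDerivAt X (hasFDerivAt_sum_sq k X))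
    · exact hasFDerivAt_const _ _
  rw [(pderiv_congr hev i).self_of_nhds, pderiv,
    HasFDerivAt.fderiv ((h1.const_mul a).fun_sub (h2.const_mul (2 * b)))]
  simp only [sub_apply, smul_apply, smul_eq_mul]
  congr 2
  · split_ifs with hi
    · subst hi; simp
    · simp
  · split_ifs with hik
    · rw [add_apply, smul_apply, smul_apply, sum_sq_apply_single, if_pos hik]
      simp
      ring
    · simp

theorem pderiv_apply {n : ℕ} (i j : Fin n) (X : E n) :
    pderiv i (fun Y : E n => Y j) X = if i = j then 1 else 0 := by
  have h : HasFDerivAt (fun X : E n => X j) (EuclideanSpace.proj j : E n →L[ℝ] ℝ) X :=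
    (EuclideanSpace.proj j : E n →L[ℝ] ℝ).hasFDerivAt
  rw [pderiv, h.fderiv]
  simp [eq_comm]

/-- The function s has |∇s|² = 4s, flat Laplacian 2k and ∂₀s = 2x, so every term containing it
collapses to a multiple of x²/s; the power of x alone gives a(3 - a). -/
theorem confLap_exp_logModel (a b : ℝ) {k : ℕ} (hk : 0 < k) (hk4 : k ≤ 4) {X : E 4}
    (hX : 0 < X 0) :
    confLap (fun Y => Y 0) (fun Y => Real.exp (logModel a b k Y)) X =
      Real.exp (logModel a b k X) * (a * (3 - a) +
        X 0 ^ 2 / (∑ i : Fin 4 with i.val < k, X i ^ 2) * (2 * b * (2 * a - 2 * b - (4 - k)))) := by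
  rw [confLap_exp (contDiffAt_logModel a b hk hX)]
  unfold confLap
  simp_rw [pderiv_pderiv_logModel a b hk hX, pderiv_logModel a b hk hX, pderiv_apply]
  congr 1
  have hs := sum_sq_pos hk hX
  generalize hS : ∑ i : Fin 4 with i.val < k, X i ^ 2 = s at hs ⊢
  have hcard : k = 1 ∨ k = 2 ∨ k = 3 ∨ k = 4 := by omega
  have hs' : X 0 ^ 2 + (if 1 < k then X 1 ^ 2 else 0) + (if 2 < k then X 2 ^ 2 else 0) +
      (if 3 < k then X 3 ^ 2 else 0) = s := by
    rw [← hS, Finset.sum_filter, Fin.sum_univ_four]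
    simp [hk]
  clear hS
  rcases hcard with rfl | rfl | rfl | rfl
  all_goals
    simp [Fin.sum_univ_four] at hs' ⊢
    field_simp
    rw [← hs']
    ring

/-! ### Limits at the sphere at infinity -/

section

variable {n : ℕ} {S : Set (E n)}

/-- The closed ball is strictly convex, so open segments between distinct points lie in the open
ball. Convexity gives unique differentiability on `S` and the mean value inequality up to the
boundary. -/
theorem convex_of_ball_subset (hball : Metric.ball 0 1 ⊆ S) (hS : S ⊆ Metric.closedBall 0 1) :
    Convex ℝ S := by
  rw [convex_iff_openSegment_subset]
  intro x hx y hy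
  by_cases hxy : x = y
  · subst hxy
    simpa using hx
  · refine Set.Subset.trans ?_ hball
    have := (strictConvex_closedBall ℝ (0 : E n) 1).openSegment_subset (hS hx) (hS hy) hxy
    rwa [interior_closedBall _ one_ne_zero] at this

theorem uniqueDiffOn_of_ball_subset (hball : Metric.ball 0 1 ⊆ S)
    (hS : S ⊆ Metric.closedBall 0 1) : UniqueDiffOn ℝ S := by
  refine uniqueDiffOn_convex (convex_of_ball_subset hball hS) ⟨0, ?_⟩
  exact mem_interior.2 ⟨_, hball, Metric.isOpen_ball, by simp⟩

theorem pderiv_eq_fderivWithin (hball : Metric.ball 0 1 ⊆ S) (u : E n → ℝ) {x : E n}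
    (hx : x ∈ Metric.ball (0 : E n) 1) (i : Fin n) :
    pderiv i u x = fderivWithin ℝ u S x (EuclideanSpace.single i 1) := by
  rw [pderiv, fderivWithin_of_mem_nhds
    (Filter.mem_of_superset (Metric.isOpen_ball.mem_nhds hx) hball)]

theorem contDiffOn_fderivWithin_apply (hball : Metric.ball 0 1 ⊆ S)
    (hS : S ⊆ Metric.closedBall 0 1) {u : E n → ℝ} (hu : ContDiffOn ℝ ∞ u S) (v : E n) :
    ContDiffOn ℝ ∞ (fun x => fderivWithin ℝ u S x v) S :=
  (hu.fderivWithin (uniqueDiffOn_of_ball_subset hball hS) (by norm_cast)).clm_apply contDiffOn_const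

/-- The derivative within `S` is continuous up to the boundary and equals the ordinary one in the
ball. -/
theorem tendsto_pderiv (hball : Metric.ball 0 1 ⊆ S) (hS : S ⊆ Metric.closedBall 0 1)
    {u : E n → ℝ} (hu : ContDiffOn ℝ ∞ u S) {ξ : E n} (hξ : ξ ∈ S) (i : Fin n) :
    Filter.Tendsto (pderiv i u) (𝓝[Metric.ball 0 1] ξ)
      (𝓝 (fderivWithin ℝ u S ξ (EuclideanSpace.single i 1))) := by
  have h := ((contDiffOn_fderivWithin_apply hball hS hu (EuclideanSpace.single i 1)).continuousOn
    ξ hξ).mono_left (nhdsWithin_mono ξ hball)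
  refine h.congr' ?_
  filter_upwards [self_mem_nhdsWithin] with x hx
  exact (pderiv_eq_fderivWithin hball u hx i).symm

theorem exists_tendsto_pderiv_pderiv (hball : Metric.ball 0 1 ⊆ S) (hS : S ⊆ Metric.closedBall 0 1)
    {u : E n → ℝ} (hu : ContDiffOn ℝ ∞ u S) {ξ : E n} (hξ : ξ ∈ S) (i : Fin n) :
    ∃ l, Filter.Tendsto (pderiv i (pderiv i u)) (𝓝[Metric.ball 0 1] ξ) (𝓝 l) := by
  refine ⟨_, (tendsto_pderiv hball hS (contDiffOn_fderivWithin_apply hball hS hu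
    (EuclideanSpace.single i 1)) hξ i).congr' ?_⟩
  filter_upwards [self_mem_nhdsWithin] with x hx
  refine (pderiv_congr ?_ i).self_of_nhds
  filter_upwards [Metric.isOpen_ball.mem_nhds hx] with y hy
  exact (pderiv_eq_fderivWithin hball u hy i).symm

/-- The derivative at a point of the sphere of a function that vanishes on the sphere is a
multiple of the conormal. -/
theorem fderivWithin_eq_of_vanishing {ρ : E n → ℝ} {ξ : E n} (hξ : ‖ξ‖ = 1)
    (hd : DifferentiableWithinAt ℝ ρ S ξ) (hnear : ∀ᶠ η in 𝓝 ξ, ‖η‖ = 1 → η ∈ S ∧ ρ η = 0)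
    (v : E n) : fderivWithin ℝ ρ S ξ v = ⟪ξ, v⟫_ℝ * fderivWithin ℝ ρ S ξ ξ := by
  set L := fderivWithin ℝ ρ S ξ with hL
  have unit : ∀ v : E n, ⟪ξ, v⟫_ℝ = 0 → ‖v‖ = 1 → L v = 0 := by
    intro v hv hv1
    -- A great circle through ξ with velocity v; ρ vanishes along it near ξ.
    let η : ℝ → E n := fun t => Real.cos t • ξ + Real.sin t • v
    have hη0 : η 0 = ξ := by simp [η]
    have hη : HasDerivAt η v 0 := by
      have h := ((Real.hasDerivAt_cos 0).smul_const ξ).fun_add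
        ((Real.hasDerivAt_sin 0).smul_const v)
      exact h.congr_deriv (by simp)
    have hη1 : ∀ t, ‖η t‖ = 1 := fun t => by
      have : ‖η t‖ ^ 2 = 1 := by
        rw [norm_add_sq_real, norm_smul, norm_smul, real_inner_smul_left, real_inner_smul_right, hv,
          hv1, hξ, mul_one, mul_one, Real.norm_eq_abs, Real.norm_eq_abs, sq_abs, sq_abs]
        linarith [Real.sin_sq_add_cos_sq t]
      exact (pow_eq_one_iff_of_nonneg (norm_nonneg _) two_ne_zero).1 this
    have hev : ∀ᶠ t in 𝓝 0, η t ∈ S ∧ ρ (η t) = 0 := by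
      have hc : Filter.Tendsto η (𝓝 0) (𝓝 ξ) := by
        have := hη.continuousAt.tendsto
        rwa [hη0] at this
      exact (hc.eventually hnear).mono fun t ht => ht (hη1 t)
    have h1 : HasDerivWithinAt (ρ ∘ η) (L v) {t | η t ∈ S} 0 := by
      have h2 : HasFDerivWithinAt ρ L S (η 0) := by rw [hη0]; exact hd.hasFDerivWithinAt
      exact h2.comp_hasDerivWithinAt 0 hη.hasDerivWithinAt fun t ht => ht
    have h3 : HasDerivAt (ρ ∘ η) (L v) 0 := h1.hasDerivAt (hev.mono fun t ht => ht.1)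
    have h4 : ρ ∘ η =ᶠ[𝓝 0] fun _ => 0 := hev.mono fun t ht => ht.2
    exact (h3.congr_of_eventuallyEq h4.symm).unique (hasDerivAt_const 0 0)
  have perp : ∀ v : E n, ⟪ξ, v⟫_ℝ = 0 → L v = 0 := by
    intro v hv
    by_cases h0 : v = 0
    · simp [h0]
    · have h1 := unit (‖v‖⁻¹ • v) (by rw [real_inner_smul_right, hv, mul_zero])
        (norm_smul_inv_norm (𝕜 := ℝ) h0)
      rw [map_smul, smul_eq_mul] at h1
      exact (mul_eq_zero.1 h1).resolve_left (inv_ne_zero (norm_ne_zero_iff.2 h0))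
  have h := perp (v - ⟪ξ, v⟫_ℝ • ξ) (by
    rw [inner_sub_right, real_inner_smul_right, real_inner_self_eq_norm_sq, hξ]; ring)
  rw [map_sub, map_smul, smul_eq_mul] at h
  linarith

/-- The mean value inequality on the radial segment from x to y = x/|x|: ρ vanishes at y, the
segment has length 1 - |x|, and the derivative is close to its value at ξ. -/
theorem tendsto_div_one_sub_norm (hball : Metric.ball 0 1 ⊆ S) (hS : S ⊆ Metric.closedBall 0 1)
    {ρ : E n → ℝ} (hρ : ContDiffOn ℝ ∞ ρ S) {ξ : E n} (hξ : ‖ξ‖ = 1) (hξS : ξ ∈ S)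
    (hnear : ∀ᶠ η in 𝓝 ξ, ‖η‖ = 1 → η ∈ S ∧ ρ η = 0) :
    Filter.Tendsto (fun x => ρ x / (1 - ‖x‖)) (𝓝[Metric.ball 0 1] ξ)
      (𝓝 (-fderivWithin ℝ ρ S ξ ξ)) := by
  set L := fderivWithin ℝ ρ S ξ with hL
  have hconv := convex_of_ball_subset hball hS
  have hcont : ContinuousWithinAt (fderivWithin ℝ ρ S) S ξ :=
    (hρ.fderivWithin (m := ∞) (uniqueDiffOn_of_ball_subset hball hS) (by norm_cast)).continuousOn
      ξ hξS
  have hx0 : Filter.Tendsto (fun x : E n => -L (‖x‖⁻¹ • x)) (𝓝[Metric.ball 0 1] ξ) (𝓝 (-L ξ)) := by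
    have : ContinuousAt (fun x : E n => -L (‖x‖⁻¹ • x)) ξ := by
      refine (L.continuous.continuousAt.comp (ContinuousAt.smul (f := fun x : E n => ‖x‖⁻¹)
        (continuous_norm.continuousAt.inv₀ (by rw [hξ]; exact one_ne_zero)) continuousAt_id)).neg
    have h := this.tendsto.mono_left (nhdsWithin_le_nhds (s := Metric.ball 0 1))
    simpa [hξ] using h
  suffices h : Filter.Tendsto (fun x => ρ x / (1 - ‖x‖) - -L (‖x‖⁻¹ • x))
      (𝓝[Metric.ball 0 1] ξ) (𝓝 0) by
    have := h.add hx0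
    simpa using this
  rw [Metric.tendsto_nhds]
  intro ε hε
  obtain ⟨δ₁, hδ₁, h1⟩ := Metric.continuousWithinAt_iff.1 hcont (ε / 2) (by positivity)
  obtain ⟨δ₂, hδ₂, h2⟩ := Metric.eventually_nhds_iff.1 hnear
  -- The bound by 1 keeps x away from 0, and x is taken within δ/2 so that its radial projection, at
  -- distance 1 - |x| ≤ |x - ξ| from x, is within δ of ξ.
  set δ := min (min δ₁ δ₂) 1 with hδ
  have hδpos : 0 < δ := lt_min (lt_min hδ₁ hδ₂) one_pos
  filter_upwards [self_mem_nhdsWithin, mem_nhdsWithin_of_mem_nhds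
    (Metric.ball_mem_nhds ξ (half_pos hδpos))] with x hx hxδ
  rw [mem_ball_zero_iff] at hx
  rw [mem_ball_iff_norm] at hxδ
  have hle : 1 - ‖x‖ ≤ ‖x - ξ‖ := by
    have := norm_sub_norm_le ξ x
    rw [hξ, norm_sub_rev] at this
    exact this
  have hxpos : 0 < ‖x‖ := by
    have : δ ≤ 1 := min_le_right _ _
    linarith
  set y := ‖x‖⁻¹ • x with hy
  have hy1 : ‖y‖ = 1 := norm_smul_inv_norm (𝕜 := ℝ) (norm_pos_iff.1 hxpos)
  have hxy : x - y = -((1 - ‖x‖) • y) := by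
    rw [hy, smul_smul, sub_mul, one_mul, mul_inv_cancel₀ hxpos.ne', sub_smul, one_smul]
    abel
  have hxyn : ‖x - y‖ = 1 - ‖x‖ := by
    rw [hxy, norm_neg, norm_smul, hy1, mul_one, Real.norm_eq_abs, abs_of_pos (by linarith)]
  have hyδ : ‖y - ξ‖ < δ := by
    calc ‖y - ξ‖ = ‖(x - ξ) - (x - y)‖ := by congr 1; abel
      _ ≤ ‖x - ξ‖ + ‖x - y‖ := norm_sub_le _ _
      _ < δ := by rw [hxyn]; linarith
  have hyS := h2 (show dist y ξ < δ₂ by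
    rw [dist_eq_norm]; exact hyδ.trans_le ((min_le_left _ _).trans (min_le_right _ _))) hy1
  have hmv : ‖ρ x - ρ y - L (x - y)‖ ≤ ε / 2 * ‖x - y‖ := by
    refine Convex.norm_image_sub_le_of_norm_hasFDerivWithin_le' (s := S ∩ Metric.ball ξ δ)
      (f' := fderivWithin ℝ ρ S) (fun z hz => ?_) (fun z hz => ?_)
      (hconv.inter (convex_ball ξ δ)) ⟨hyS.1, by rwa [mem_ball_iff_norm]⟩
      ⟨hball (by simpa using hx), by rw [mem_ball_iff_norm]; linarith⟩
    · exact ((hρ.differentiableOn (by simp)) z hz.1).hasFDerivWithinAt.mono Set.inter_subset_left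
    · rw [← dist_eq_norm]
      exact (h1 hz.1 ((Metric.mem_ball.1 hz.2).trans_le
        ((min_le_left _ _).trans (min_le_left _ _)))).le
  have hpos : 0 < 1 - ‖x‖ := by linarith
  rw [hyS.2, sub_zero, hxyn, hxy, map_neg, map_smul, smul_eq_mul, Real.norm_eq_abs] at hmv
  rw [Real.dist_eq, sub_zero, show ρ x / (1 - ‖x‖) - -L y =
    (ρ x - -((1 - ‖x‖) * L y)) / (1 - ‖x‖) by field_simp, abs_div, abs_of_pos hpos, div_lt_iff₀ hpos]
  nlinarith

/-- At a point at infinity where `ρ` vanishes to first order, the quotient of `Δ (ρ^a e^g)` by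
`ρ^a e^g` tends to `a (n - 1 - a)`. -/
theorem tendsto_confLap_boundary (hball : Metric.ball 0 1 ⊆ S) (hS : S ⊆ Metric.closedBall 0 1)
    {ρ g : E n → ℝ} (hρ : ContDiffOn ℝ ∞ ρ S) (hg : ContDiffOn ℝ ∞ g S) {ξ : E n} (hξ : ‖ξ‖ = 1)
    (hξS : ξ ∈ S) (hnear : ∀ᶠ η in 𝓝 ξ, ‖η‖ = 1 → η ∈ S ∧ ρ η = 0)
    (hpos : ∀ x ∈ Metric.ball (0 : E n) 1, 0 < ρ x) (hD : fderivWithin ℝ ρ S ξ ≠ 0) (a : ℝ) :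
    Filter.Tendsto (fun x => confLap ballFactor (fun y => a * Real.log (ρ y) + g y) x -
      ballFactor x ^ 2 * ∑ i, pderiv i (fun y => a * Real.log (ρ y) + g y) x ^ 2)
      (𝓝[Metric.ball 0 1] ξ) (𝓝 (a * (n - 1 - a))) := by
  set f : E n → ℝ := fun y => a * Real.log (ρ y) + g y with hf
  set c := -fderivWithin ℝ ρ S ξ ξ with hc
  have hL := fderivWithin_eq_of_vanishing hξ (hρ.differentiableOn (by simp) ξ hξS) hnear
  -- The derivative of ρ at ξ is a multiple of the conormal, so it is nonzero only if its radial
  -- part is.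
  have hc0 : c ≠ 0 := fun h => hD (by
    ext v
    rw [hL v, neg_eq_zero.1 (hc.symm.trans h)]
    simp)
  have hat : ∀ u : E n → ℝ, ContDiffOn ℝ ∞ u S → ∀ x ∈ Metric.ball (0 : E n) 1,
      ContDiffAt ℝ 2 u x := fun u hu x hx =>
    (hu.contDiffAt (Filter.mem_of_superset (Metric.isOpen_ball.mem_nhds hx) hball)).of_le
      (by norm_cast)
  have hdf : ∀ x ∈ Metric.ball (0 : E n) 1, ∀ i, pderiv i f x =
      a * (pderiv i ρ x / ρ x) + pderiv i g x := fun x hx i => by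
    have h1 := ((hat ρ hρ x hx).differentiableAt (by norm_num)).hasFDerivAt
    have h2 := ((hat g hg x hx).differentiableAt (by norm_num)).hasFDerivAt
    rw [pderiv, HasFDerivAt.fderiv (f := f) (((h1.log (hpos x hx).ne').const_mul a).add h2)]
    simp only [add_apply, smul_apply, smul_eq_mul, pderiv]
    ring
  have hddf : ∀ x ∈ Metric.ball (0 : E n) 1, ∀ i, pderiv i (pderiv i f) x =
      a * (pderiv i (pderiv i ρ) x / ρ x - (pderiv i ρ x / ρ x) ^ 2) +
        pderiv i (pderiv i g) x := fun x hx i => by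
    have hev : pderiv i f =ᶠ[𝓝 x] fun y => a * (pderiv i ρ y * (ρ y)⁻¹) + pderiv i g y := by
      filter_upwards [Metric.isOpen_ball.mem_nhds hx] with y hy
      rw [hdf y hy i, div_eq_mul_inv]
    have h0 := ((hat ρ hρ x hx).differentiableAt (by norm_num)).hasFDerivAt
    have h1 := (hat ρ hρ x hx).hasFDerivAt_pderiv i
    have h2 := (hat g hg x hx).hasFDerivAt_pderiv i
    have h3 := h1.mul ((hasDerivAt_inv (hpos x hx).ne').comp_hasFDerivAt x h0)
    have h4 : HasFDerivAt (fun y => a * (pderiv i ρ y * (ρ y)⁻¹) + pderiv i g y) _ x :=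
      (h3.const_mul a).add h2
    have hne := (hpos x hx).ne'
    rw [(pderiv_congr hev i).self_of_nhds, pderiv, h4.fderiv, (hat ρ hρ x hx).pderiv_pderiv,
      (hat g hg x hx).pderiv_pderiv]
    simp
    simp only [pderiv]
    field_simp
    ring
  have hβ : Filter.Tendsto (ballFactor (n := n)) (𝓝[Metric.ball 0 1] ξ) (𝓝 0) := by
    have := (hasFDerivAt_ballFactor ξ).continuousAt.tendsto.mono_left
      (nhdsWithin_le_nhds (s := Metric.ball 0 1))
    simpa [ballFactor, hξ] using this
  -- Although 1/ρ blows up, d/ρ has the finite limit 1/c and ∂ᵢρ tends to -cξᵢ. So d ∂ᵢρ/ρ tends to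
  -- -ξᵢ, independently of ρ, and the terms with g or with second derivatives of ρ keep a factor d
  -- and vanish.
  have hκ : Filter.Tendsto (fun x => ballFactor x / ρ x) (𝓝[Metric.ball 0 1] ξ) (𝓝 c⁻¹) := by
    have h1 := (tendsto_div_one_sub_norm hball hS hρ hξ hξS hnear).inv₀ hc0
    have h2 : Filter.Tendsto (fun x : E n => (1 + ‖x‖) / 2) (𝓝[Metric.ball 0 1] ξ) (𝓝 1) := by
      have : Continuous fun x : E n => (1 + ‖x‖) / 2 := by fun_prop
      have := (this.tendsto ξ).mono_left (nhdsWithin_le_nhds (s := Metric.ball 0 1))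
      simpa [hξ] using this
    have h3 := h2.mul h1
    rw [one_mul] at h3
    refine h3.congr' ?_
    filter_upwards [self_mem_nhdsWithin] with x hx
    rw [inv_div, ballFactor]
    ring
  have hρ1 : ∀ i, Filter.Tendsto (pderiv i ρ) (𝓝[Metric.ball 0 1] ξ) (𝓝 (-c * ξ i)) := fun i => by
    have h := tendsto_pderiv hball hS hρ hξS i
    rw [hL] at h
    convert h using 2
    simp [hc, EuclideanSpace.inner_single_right]
    ring
  have hg1 := tendsto_pderiv hball hS hg hξS
  choose lρ hρ2 using fun i => exists_tendsto_pderiv_pderiv hball hS hρ hξS i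
  choose lg hg2 using fun i => exists_tendsto_pderiv_pderiv hball hS hg hξS i
  have hxi : ∀ i, Filter.Tendsto (fun x : E n => x i) (𝓝[Metric.ball 0 1] ξ) (𝓝 (ξ i)) := fun i =>
    ((by fun_prop : Continuous fun x : E n => x i).tendsto ξ).mono_left nhdsWithin_le_nhds
  have hP : ∀ i, Filter.Tendsto (fun x => a * (ballFactor x / ρ x * pderiv i ρ x) +
      ballFactor x * pderiv i g x) (𝓝[Metric.ball 0 1] ξ) (𝓝 (-a * ξ i)) := fun i => by
    convert ((hκ.mul (hρ1 i)).const_mul a).add (hβ.mul (hg1 i)) using 2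
    field_simp
    ring
  have hQ : ∀ i, Filter.Tendsto (fun x => a * (ballFactor x * (ballFactor x / ρ x) *
      pderiv i (pderiv i ρ) x - (ballFactor x / ρ x * pderiv i ρ x) ^ 2) +
      ballFactor x ^ 2 * pderiv i (pderiv i g) x) (𝓝[Metric.ball 0 1] ξ)
      (𝓝 (-a * ξ i ^ 2)) := fun i => by
    convert ((((hβ.mul hκ).mul (hρ2 i)).sub ((hκ.mul (hρ1 i)).pow 2)).const_mul a).add
      ((hβ.pow 2).mul (hg2 i)) using 2
    field_simp
    ring
  have hsum : Filter.Tendsto (fun x => ∑ i, (-(a * (ballFactor x * (ballFactor x / ρ x) *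
      pderiv i (pderiv i ρ) x - (ballFactor x / ρ x * pderiv i ρ x) ^ 2) +
      ballFactor x ^ 2 * pderiv i (pderiv i g) x) - (n - 2) * (x i *
      (a * (ballFactor x / ρ x * pderiv i ρ x) + ballFactor x * pderiv i g x)) -
      (a * (ballFactor x / ρ x * pderiv i ρ x) + ballFactor x * pderiv i g x) ^ 2))
      (𝓝[Metric.ball 0 1] ξ)
      (𝓝 (∑ i, (-(-a * ξ i ^ 2) - (n - 2) * (ξ i * (-a * ξ i)) - (-a * ξ i) ^ 2))) :=
    tendsto_finsetSum _ fun i _ => ((hQ i).neg.sub (((hxi i).mul (hP i)).const_mul _)).sub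
      ((hP i).pow 2)
  have hlim : ∑ i, (-(-a * ξ i ^ 2) - (n - 2) * (ξ i * (-a * ξ i)) - (-a * ξ i) ^ 2) =
      a * (n - 1 - a) := by
    have h1 : ∑ i, ξ i ^ 2 = 1 := by rw [← EuclideanSpace.real_norm_sq_eq, hξ, one_pow]
    calc _ = ∑ i, (a * (n - 1 - a)) * ξ i ^ 2 := Finset.sum_congr rfl fun i _ => by ring
      _ = _ := by rw [← Finset.mul_sum, h1, mul_one]
  rw [hlim] at hsum
  refine hsum.congr' ?_
  filter_upwards [self_mem_nhdsWithin] with x hx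
  have hne := (hpos x hx).ne'
  unfold confLap
  rw [Finset.mul_sum, Finset.mul_sum, Finset.mul_sum, ← Finset.sum_add_distrib,
    ← Finset.sum_sub_distrib]
  refine Finset.sum_congr rfl fun i _ => ?_
  rw [hdf x hx, hddf x hx, pderiv_ballFactor]
  field_simp
  ring

end

/-! ### Estimates near Ω and in the cusps, and the two implications -/

section

variable {Γ : Subgroup (ClosedBall 4 ≃ₜ ClosedBall 4)} {nc : ℕ} {G : GeometricallyFinite Γ nc}

theorem eventually_mem_Omega {n : ℕ} {Γ : Subgroup (ClosedBall n ≃ₜ ClosedBall n)}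
    {ξ : ClosedBall n} (hξ : ξ ∈ Omega Γ) :
    ∀ᶠ η in 𝓝 (ξ : E n), ‖η‖ = 1 → ∃ w ∈ Omega Γ, (w : E n) = η := by
  have hcl : IsClosed (Subtype.val '' limitSet Γ : Set (E n)) :=
    (Metric.isClosed_closedBall.isClosedEmbedding_subtypeVal).isClosedMap _ (isClosed_limitSet Γ)
  have hn : (ξ : E n) ∉ Subtype.val '' limitSet Γ := by
    rintro ⟨w, hw, h⟩
    exact hξ.2 (Subtype.ext h ▸ hw)
  filter_upwards [hcl.isOpen_compl.mem_nhds hn] with η hη h1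
  exact ⟨⟨η, by simp [h1]⟩, ⟨h1, fun h => hη ⟨_, h, rfl⟩⟩, rfl⟩

theorem image_innerOmega_subset {n : ℕ} {Γ : Subgroup (ClosedBall n ≃ₜ ClosedBall n)} :
    Subtype.val '' innerOmega Γ ⊆ Metric.closedBall (0 : E n) 1 := by
  rintro _ ⟨w, _, rfl⟩
  exact w.2

theorem confLap_sigmaPow {n : ℕ} [NeZero n] {Γ : Subgroup (ClosedBall n ≃ₜ ClosedBall n)}
    {G : GeometricallyFinite Γ nc} (D : DefiningFunctions G) (μ₀ : ℝ) (μ : Fin nc → ℝ) {x : E n}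
    (hx : ‖x‖ < 1) :
    confLap ballFactor (sigmaPow D μ₀ μ) x = sigmaPow D μ₀ μ x *
      (confLap ballFactor (logSigma D μ₀ μ) x -
        ballFactor x ^ 2 * ∑ i, pderiv i (logSigma D μ₀ μ) x ^ 2) := by
  rw [confLap_congr (sigmaPow_eventuallyEq D μ₀ μ hx),
    confLap_exp ((contDiffAt_logSigma D μ₀ μ hx).of_le (by norm_cast)), sigmaPow_eq_exp D μ₀ μ hx]

/-- The asymptotic estimate at points near `Ω_Γ`. -/
theorem exists_isOpen_estimate {n : ℕ} [NeZero n] {Γ : Subgroup (ClosedBall n ≃ₜ ClosedBall n)}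
    {G : GeometricallyFinite Γ nc} (D : DefiningFunctions G) (μ₀ : ℝ) (μ : Fin nc → ℝ) {c : ℝ}
    (hc : c < μ₀ * (n - 1 - μ₀)) {ξ : ClosedBall n} (hξ : ξ ∈ Omega Γ) :
    ∃ O : Set (ClosedBall n), IsOpen O ∧ ξ ∈ O ∧ ∀ w ∈ O, w ∈ inner n →
      c * sigmaPow D μ₀ μ (w : E n) ≤ confLap ballFactor (sigmaPow D μ₀ μ) (w : E n) := by
  have hξS : (ξ : E n) ∈ Subtype.val '' innerOmega Γ := ⟨ξ, Or.inr hξ, rfl⟩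
  have hg : ContDiffOn ℝ ∞ (fun x => ∑ j, μ j * Real.log (lift Γ (D.r j) x))
      (Subtype.val '' innerOmega Γ) :=
    ContDiffOn.sum fun j _ => contDiffOn_const.mul ((D.r_smooth j).log (by
      rintro _ ⟨w, hw, rfl⟩
      exact (lift_r_pos D j hw).ne'))
  have h := tendsto_confLap_boundary ball_subset_image_innerOmega image_innerOmega_subset
    D.ρ_smooth hg hξ.1 hξS ((eventually_mem_Omega hξ).mono fun η h h1 => by
      obtain ⟨w, hw, rfl⟩ := h h1
      refine ⟨⟨w, Or.inr hw, rfl⟩, ?_⟩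
      rw [lift_apply D.ρ ⟨w, Or.inr hw⟩]
      exact D.ρ_zero _ hw)
    (fun x hx => lift_ρ_pos D (by simpa using hx)) (D.ρ_deriv ξ hξ) μ₀
  obtain ⟨U, hU, hξU, hUS⟩ := mem_nhdsWithin.1 (h.eventually (lt_mem_nhds hc))
  refine ⟨Subtype.val ⁻¹' U, hU.preimage continuous_subtype_val, hξU, fun w hw hwi => ?_⟩
  have h1 : c < confLap ballFactor (logSigma D μ₀ μ) w -
        ballFactor (w : E n) ^ 2 * ∑ i, pderiv i (logSigma D μ₀ μ) w ^ 2 :=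
    hUS ⟨hw, by simpa using (show ‖(w : E n)‖ < 1 from hwi)⟩
  rw [confLap_sigmaPow D μ₀ μ hwi, mul_comm]
  exact mul_le_mul_of_nonneg_left h1.le (sigmaPow_pos D μ₀ μ hwi).le

/-- The Laplacian of the weight far enough in a cusp. -/
theorem exists_confLap_sigmaPow_cusp (D : DefiningFunctions G) (j : Fin nc) :
    ∃ R', ∀ (μ₀ : ℝ) (μ : Fin nc → ℝ), ∀ w ∈ inner 4, R' < (G.cusp j).normSq w →
      confLap ballFactor (sigmaPow D μ₀ μ) (w : E 4) = sigmaPow D μ₀ μ (w : E 4) *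
        (μ₀ * (3 - μ₀) + (G.cusp j).coord w 0 ^ 2 / (G.cusp j).normSq w *
          ((μ₀ + μ j) * (μ₀ - μ j - (G.cusp j).rank))) := by
  obtain ⟨R', hR', hform⟩ := D.cusp_form j
  refine ⟨R', fun μ₀ μ w hw hs => ?_⟩
  set c := G.cusp j
  obtain ⟨Φ, hΦ⟩ := c.exists_laplaceEquivariant_coord
  have hk := c.codim_pos
  have hx0 := c.coord_zero_pos hw
  obtain ⟨h1, h2⟩ := hΦ w hw
  -- Here ρ = x s^(-1/2) and rⱼ = s^(-1/2), so s carries the exponent -(μ₀ + μⱼ)/2.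
  let b := (μ₀ + μ j) / 2
  have hsig : ∀ v ∈ inner 4, R' < c.normSq v →
      sigmaPow D μ₀ μ (v : E 4) = Real.exp (logModel μ₀ b (4 - c.rank) (c.coord v)) := by
    intro v hv hvs
    have hvr : v ∈ c.region R' := ⟨c.ne_p_of_mem_inner hv, hvs.le⟩
    have hvr' : v ∈ c.region (G.R j) := ⟨hvr.1, hR'.trans hvs.le⟩
    obtain ⟨f1, f2⟩ := hform ⟨v, inner_subset_innerOmega hv⟩ hvr
    -- The cusp regions are disjoint, so the other defining functions are 1 here.
    have f3 : ∀ i, i ≠ j → D.r i (projBar Γ ⟨v, inner_subset_innerOmega hv⟩) = 1 := fun i hi =>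
      D.r_eq_one i _ fun hm => (G.disjoint i j hi).le_bot ⟨hm, _, hvr', rfl⟩
    have hpos := sum_sq_pos hk (c.coord_zero_pos hv)
    change 0 < c.normSq v at hpos
    rw [sigmaPow_eq_exp D μ₀ μ hv]
    congr 1
    unfold logSigma logModel
    change _ = μ₀ * Real.log (c.coord v 0) - b * Real.log (c.normSq v)
    rw [Finset.sum_eq_single j, lift_apply_inner _ hv, lift_apply_inner _ hv, f1, f2,
      Real.log_div (c.coord_zero_pos hv).ne' (Real.sqrt_pos.2 hpos).ne', one_div, Real.log_inv,
      Real.log_sqrt hpos.le]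
    · ring
    · intro i _ hi
      rw [lift_apply_inner _ hv, f3 i hi, Real.log_one, mul_zero]
    · simp
  have hev : sigmaPow D μ₀ μ =ᶠ[𝓝 (w : E 4)]
      (fun X => Real.exp (logModel μ₀ b (4 - c.rank) X)) ∘ Φ := by
    have hcont : ContinuousAt (fun y => ∑ i : Fin 4 with i.val < 4 - c.rank, Φ y i ^ 2)
        (w : E 4) := by
      have : Continuous fun X : E 4 => ∑ i : Fin 4 with i.val < 4 - c.rank, X i ^ 2 := by fun_prop
      exact this.continuousAt.comp h2.contDiffAt.continuousAt
    have hR : R' < ∑ i : Fin 4 with i.val < 4 - c.rank, Φ w i ^ 2 := by rw [h1]; exact hs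
    filter_upwards [eventually_norm_lt_one hw, hcont.eventually (lt_mem_nhds hR)] with y hy hys
    have hy' : (⟨y, by simpa using hy.le⟩ : ClosedBall 4) ∈ inner 4 := hy
    have h3 : Φ y = _ := (hΦ _ hy').1
    rw [h3] at hys
    have := hsig _ hy' hys
    rw [Function.comp_apply, h3]
    exact this
  have hsmooth : ContDiffAt ℝ 2 (fun X => Real.exp (logModel μ₀ b (4 - c.rank) X)) (Φ w) := by
    rw [h1]
    exact (contDiffAt_logModel μ₀ b hk hx0).exp
  rw [(confLap_ballFactor_eq h2 hsmooth hev).2, h1,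
    confLap_exp_logModel μ₀ b hk (Nat.sub_le _ _) hx0, hsig w hw hs]
  congr 2
  have hr : c.rank ≤ 4 := c.rank_le.trans (by norm_num)
  rw [Nat.cast_sub hr]
  change c.coord w 0 ^ 2 / c.normSq w * _ = _
  congr 1
  simp only [b]
  push_cast
  ring

/-- Points far enough in a cusp lie outside any given compact subset of `M`. -/
theorem exists_forall_proj_not_mem {n : ℕ} [NeZero n]
    {Γ : Subgroup (ClosedBall n ≃ₜ ClosedBall n)} (G : GeometricallyFinite Γ nc) (j : Fin nc)
    {Mc : Set (Mfd Γ)} (hMc : IsCompact Mc) :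
    ∃ s₀ : ℝ, ∀ w : inner n, s₀ < (G.cusp j).normSq w → proj Γ w ∉ Mc := by
  have hΓ := G.kleinian.isom
  set c := G.cusp j
  obtain ⟨r, hr, hcov⟩ := exists_radius_of_isCompact hΓ hMc
  have ho : origin n ∈ inner n := by simp [origin, inner]
  obtain ⟨C, hC, hbd⟩ : ∃ C : ℝ, 0 ≤ C ∧ ∀ v : inner n, ‖((v : ClosedBall n) : E n)‖ ≤ r →
      ‖((v : ClosedBall n) : E n)‖ ^ 2 ≤
        C * (ballFactor ((v : ClosedBall n) : E n) * ballFactor (origin n : E n)) := by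
    -- The factors at v and at the centre are at least (1 - r²)/2 and equal to 1/2, so the first
    -- constant makes the right side at least 1. The maximum with 0 covers r < -1, when no such v
    -- exists.
    refine ⟨4 / (1 - r ^ 2) ⊔ 0, le_max_right _ _, fun v hv => ?_⟩
    have hv0 := norm_nonneg ((v : ClosedBall n) : E n)
    have hr0 : 0 < 1 - r ^ 2 := by nlinarith
    have hb : ballFactor (origin n : E n) = 1 / 2 := by simp [ballFactor, origin]
    have hbv : (1 - r ^ 2) / 2 ≤ ballFactor ((v : ClosedBall n) : E n) := by
      unfold ballFactor
      nlinarith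
    have hle : 4 / (1 - r ^ 2) * ((1 - r ^ 2) / 2 * (1 / 2)) ≤ (4 / (1 - r ^ 2) ⊔ 0) *
        (ballFactor ((v : ClosedBall n) : E n) * ballFactor (origin n : E n)) := by
      rw [hb]
      gcongr
      exact le_max_left _ _
    have h1 : 4 / (1 - r ^ 2) * ((1 - r ^ 2) / 2 * (1 / 2)) = 1 := by field_simp; norm_num
    nlinarith
  -- A point over `Mc` is at bounded distance from the orbit of the centre, so its s is at most a
  -- constant times that of an orbit point.
  have hcmp : ∀ w : inner n, proj Γ w ∈ Mc → ∃ γ ∈ Γ, γ (origin n) ∈ inner n ∧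
      c.normSq w ≤ (2 + C) ^ 2 * c.normSq (γ (origin n)) := by
    intro w hw
    obtain ⟨γ, hγ, v, hv, hvw⟩ := hcov w hw
    have hγo := ((hΓ hγ).1 _).2 ho
    refine ⟨γ, hγ, hγo, ?_⟩
    have h1 := c.norm_coord_sub_sq w.2 hγo
    have h2 := norm_sub_sq_of_mem_hypIsom (hΓ hγ) v.2 ho
    rw [hvw] at h2
    have p1 := ballFactor_pos w.2
    have p2 := ballFactor_pos hγo
    have p3 := ballFactor_pos v.2
    have p4 := ballFactor_pos ho
    have q1 := c.coord_zero_pos w.2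
    have q2 := c.coord_zero_pos hγo
    have h3 := hbd v hv
    have ho0 : ‖((v : ClosedBall n) : E n) - origin n‖ = ‖((v : ClosedBall n) : E n)‖ := by
      simp [origin]
    rw [ho0] at h2
    have h4 : ‖((w : ClosedBall n) : E n) - γ (origin n)‖ ^ 2 ≤
        C * (ballFactor ((w : ClosedBall n) : E n) * ballFactor (γ (origin n) : E n)) := by
      refine le_of_mul_le_mul_right ?_ (mul_pos p3 p4)
      rw [h2]
      calc _ ≤ (C * (ballFactor ((v : ClosedBall n) : E n) * ballFactor (origin n : E n))) *
            (ballFactor ((w : ClosedBall n) : E n) * ballFactor (γ (origin n) : E n)) := by gcongr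
        _ = _ := by ring
    have h5 : ‖c.coord w - c.coord (γ (origin n))‖ ^ 2 ≤
        C * (c.coord (γ (origin n)) 0 * c.coord w 0) := by
      refine le_of_mul_le_mul_right ?_ (mul_pos p1 p2)
      rw [h1]
      calc _ ≤ (C * (ballFactor ((w : ClosedBall n) : E n) * ballFactor (γ (origin n) : E n))) *
            (c.coord w 0 * c.coord (γ (origin n)) 0) := by gcongr
        _ = _ := by ring
    have h6 := norm_trunc_le_of_norm_sub_le c.codim_pos hC q2.le q1.le h5
    rw [c.normSq_eq, c.normSq_eq, ← mul_pow]
    exact pow_le_pow_left₀ (norm_nonneg _) h6 2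
  -- By precise invariance, orbit points of the centre in the cusp region differ by elements of the
  -- stabilizer, so they all have the same s. Hence s is bounded on the whole orbit.
  by_cases hex : ∃ γ ∈ Γ, γ (origin n) ∈ c.region (G.R j)
  · obtain ⟨γ₀, hγ₀, hreg⟩ := hex
    refine ⟨(2 + C) ^ 2 * max (G.R j) (c.normSq (γ₀ (origin n))), fun w hw hMw => ?_⟩
    obtain ⟨γ, hγ, hγo, hle⟩ := hcmp w hMw
    have hlt : max (G.R j) (c.normSq (γ₀ (origin n))) < c.normSq (γ (origin n)) :=
      lt_of_mul_lt_mul_left (hw.trans_le hle) (by positivity)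
    have hreg' : γ (origin n) ∈ c.region (G.R j) :=
      ⟨c.ne_p_of_mem_inner hγo, ((le_max_left _ _).trans hlt.le)⟩
    have hτ : γ * γ₀⁻¹ ∈ stab Γ c.p := by
      by_contra hns
      refine (G.precisely_invariant j _ (Γ.mul_mem hγ (Γ.inv_mem hγ₀)) hns).le_bot
        ⟨⟨γ₀ (origin n), hreg, ?_⟩, hreg'⟩
      change γ (γ₀.symm (γ₀ (origin n))) = _
      rw [Homeomorph.symm_apply_apply]
    have h1 := c.normSq_stab hΓ hτ hreg.1
    have h2 : (γ * γ₀⁻¹) (γ₀ (origin n)) = γ (origin n) :=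
      congrArg γ (γ₀.symm_apply_apply (origin n))
    rw [h2] at h1
    exact absurd hlt (by rw [h1]; exact not_lt.2 (le_max_right _ _))
  · refine ⟨(2 + C) ^ 2 * G.R j, fun w hw hMw => ?_⟩
    obtain ⟨γ, hγ, hγo, hle⟩ := hcmp w hMw
    have hlt : G.R j < c.normSq (γ (origin n)) :=
      lt_of_mul_lt_mul_left (hw.trans_le hle) (by positivity)
    exact hex ⟨γ, hγ, c.ne_p_of_mem_inner hγo, hlt.le⟩

/-- Any asymptotic estimate holds for the model operator far enough in the cusps. -/
theorem AsymptoticEstimate.model {D : DefiningFunctions G} {K μ₀ : ℝ} {μ : Fin nc → ℝ}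
    (h : AsymptoticEstimate D K μ₀ μ) (j : Fin nc) : ∃ δ > 0, ∃ s₀ : ℝ, ∀ X : E 4, 0 < X 0 →
      s₀ < ∑ i : Fin 4 with i.val < 4 - (G.cusp j).rank, X i ^ 2 →
      δ ≤ μ₀ * (3 - μ₀) + X 0 ^ 2 / (∑ i : Fin 4 with i.val < 4 - (G.cusp j).rank, X i ^ 2) *
          ((μ₀ + μ j) * (μ₀ - μ j - (G.cusp j).rank)) + K := by
  obtain ⟨Mc, hMc, δ, hδ, hest⟩ := h
  obtain ⟨s₀, hs₀⟩ := exists_forall_proj_not_mem G j hMc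
  obtain ⟨R', hR'⟩ := exists_confLap_sigmaPow_cusp D j
  refine ⟨δ, hδ, max s₀ R', fun X hX hs => ?_⟩
  set c := G.cusp j
  have hw := c.ofCoord_mem_inner hX
  have hcoord := c.coord_ofCoord hX.le
  have hns : c.normSq (c.ofCoord X hX.le) =
      ∑ i : Fin 4 with i.val < 4 - c.rank, X i ^ 2 := by rw [Cusp.normSq, hcoord]
  rw [← hns] at hs
  have h1 := hest ⟨_, hw⟩ (hs₀ ⟨_, hw⟩ ((le_max_left _ _).trans_lt hs))
  have h2 := hR' μ₀ μ _ hw ((le_max_right _ _).trans_lt hs)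
  have hpos := sigmaPow_pos D μ₀ μ hw
  rw [laplacian_ballMetric hw (contDiffAt_sigmaPow D μ₀ μ hw), h2, hcoord, hns] at h1
  refine le_of_mul_le_mul_left ?_ hpos
  linarith

/-- The model inequality is tested at t = 1, and for rank two also as t tends to 0; rank three has
no y coordinate, so only t = 1 occurs. -/
theorem rank_eq_one_of_asymptoticEstimate {D : DefiningFunctions G} {μ₀ : ℝ} {μ : Fin nc → ℝ}
    (hμ : ∀ j, 0 < μ j) (h : AsymptoticEstimate D (-2) μ₀ μ) (j : Fin nc) :
    (G.cusp j).rank = 1 := by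
  obtain ⟨δ, hδ, s₀, hs₀⟩ := h.model j
  have h1 := (G.cusp j).one_le_rank
  have h3 : (G.cusp j).rank ≤ 3 := (G.cusp j).rank_le
  have hμj := hμ j
  generalize (G.cusp j).rank = f at *
  generalize μ j = m at *
  have hN : ∃ N : ℝ, 1 ≤ N ∧ s₀ < N ^ 2 := ⟨|s₀| + 1, by simp, by
    nlinarith [abs_nonneg s₀, le_abs_self s₀]⟩
  have hsum : ∀ x y : ℝ, ∑ i : Fin 4 with i.val < 4 - f, (!₂[x, y, 0, 0] : E 4) i ^ 2 =
      x ^ 2 + if f ≤ 2 then y ^ 2 else 0 := by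
    intro x y
    rw [Finset.sum_filter, Fin.sum_univ_four]
    have a1 : 0 < 4 - f := by omega
    have a2 : 1 < 4 - f ↔ f ≤ 2 := by omega
    simp [a1, a2]
  -- The point with y = 0 and large height, where t = 1.
  have hdiag : δ ≤ μ₀ * (3 - μ₀) + (μ₀ + m) * (μ₀ - m - f) + -2 := by
    obtain ⟨N, hN1, hN⟩ := hN
    have := hs₀ !₂[N, 0, 0, 0] (by simp; linarith) (by rw [hsum]; simpa using hN)
    rw [hsum] at this
    have hN0 : N ≠ 0 := by linarith
    simpa [hN0] using this
  obtain rfl | rfl | rfl : f = 1 ∨ f = 2 ∨ f = 3 := by omega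
  · rfl
  · exfalso
    push_cast at hs₀ hdiag
    have ha : 2 < μ₀ := by nlinarith
    set c := (μ₀ + m) * (μ₀ - m - 2)
    -- Height 1 and y = N give t = 1/(1 + N²), small enough that the t-term stays below δ; this
    -- leaves μ₀(3 - μ₀) > 2, which contradicts μ₀ > 2.
    obtain ⟨N, hN1, hNs, hNc⟩ : ∃ N : ℝ, 1 ≤ N ∧ s₀ < N ^ 2 ∧ c / (1 + N ^ 2) < δ := by
      refine ⟨|s₀| + |c| / δ + 1, ?_, ?_, ?_⟩
      · have : 0 ≤ |s₀| + |c| / δ := by positivity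
        linarith
      · have : 0 ≤ |c| / δ := by positivity
        nlinarith [abs_nonneg s₀, le_abs_self s₀]
      · have h4 : |c| / δ < 1 + (|s₀| + |c| / δ + 1) ^ 2 := by
          have : 0 ≤ |c| / δ := by positivity
          nlinarith [abs_nonneg s₀]
        rw [div_lt_iff₀ (by positivity)]
        rw [div_lt_iff₀ hδ] at h4
        linarith [le_abs_self c]
    have := hs₀ !₂[1, N, 0, 0] (by simp) (by rw [hsum]; simp; linarith)
    rw [hsum] at this
    simp only [le_refl, if_true, one_pow] at this
    have h5 : (![(1 : ℝ), N, 0, 0] : Fin 4 → ℝ) 0 = 1 := rfl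
    rw [h5, one_pow, div_mul_eq_mul_div, one_mul] at this
    nlinarith
  · exfalso
    -- For rank three the inequality becomes δ ≤ -(m + 1)(m + 2), where m > 0.
    push_cast at hdiag
    nlinarith

/-- If the estimate holds far enough in the cusps, it holds outside a compact set. -/
theorem exists_radius_of_cusp_estimate (D : DefiningFunctions G) {μ₀ c : ℝ} {μ : Fin nc → ℝ}
    (hc : c < μ₀ * (3 - μ₀)) {R' : Fin nc → ℝ}
    (hcusp : ∀ j, ∀ w ∈ inner 4, R' j < (G.cusp j).normSq w →
      c * sigmaPow D μ₀ μ (w : E 4) ≤ confLap ballFactor (sigmaPow D μ₀ μ) (w : E 4)) :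
    ∃ r < 1, ∀ w : inner 4, proj Γ w ∉ proj Γ '' {v | ‖((v : ClosedBall 4) : E 4)‖ ≤ r} →
      c * sigmaPow D μ₀ μ (w : ClosedBall 4) ≤
        confLap ballFactor (sigmaPow D μ₀ μ) (w : ClosedBall 4) := by
  have hΓ := G.kleinian.isom
  let est : ClosedBall 4 → Prop := fun w =>
    c * sigmaPow D μ₀ μ (w : E 4) ≤ confLap ballFactor (sigmaPow D μ₀ μ) (w : E 4)
  have est_apply : ∀ γ ∈ Γ, ∀ w ∈ inner 4, est w → est (γ w) := fun γ hγ w hw h => by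
    simp only [est]
    rw [sigmaPow_invariant D μ₀ μ hγ hw, confLap_sigmaPow_invariant D μ₀ μ hγ hw]
    exact h
  let incl : inner 4 → innerOmega Γ := fun w => ⟨w, inner_subset_innerOmega w.2⟩
  have hequiv : ∀ (w : inner 4) (u : innerOmega Γ), projBar Γ u = projBar Γ (incl w) →
      ∃ γ ∈ Γ, (u : ClosedBall 4) ∈ inner 4 ∧ γ u = (w : ClosedBall 4) := fun w u h => by
    obtain ⟨γ, hγ, h⟩ := projBar_eq_iff.1 h
    exact ⟨γ, hγ, ((hΓ hγ).1 _).1 (h ▸ w.2), h⟩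
  obtain ⟨C₀, hC₀, hcover⟩ := G.decomposition
  choose K hK hKsub hKcov using fun j =>
    (G.cusp j).exists_isCompact_subset_region hΓ (G.R j) (R' j)
  have hKb : ∀ j, IsCompact (projBar Γ '' (Subtype.val ⁻¹' K j)) := fun j => by
    have hcont : Continuous (projBar Γ) := continuous_quotient_mk'
    refine IsCompact.image ?_ hcont
    rw [Subtype.isCompact_iff, Subtype.image_preimage_coe,
      Set.inter_eq_right.2 ((hKsub j).trans (G.region_subset j))]
    exact hK j
  have hcompact : IsCompact (C₀ ∪ ⋃ j, projBar Γ '' (Subtype.val ⁻¹' K j)) :=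
    hC₀.union (isCompact_iUnion hKb)
  obtain ⟨r, hr, hgood⟩ : ∃ r < 1, ∀ w : inner 4,
      projBar Γ (incl w) ∈ C₀ ∪ ⋃ j, projBar Γ '' (Subtype.val ⁻¹' K j) →
      est w ∨ proj Γ w ∈ proj Γ '' {v | ‖((v : ClosedBall 4) : E 4)‖ ≤ r} := by
    -- The property is monotone and stable under unions. Locally it holds at inner points because a
    -- neighbourhood is covered by a smaller ball, and at points of Ω by the boundary limit.
    refine hcompact.induction_on (p := fun s => ∃ r < 1, ∀ w : inner 4, projBar Γ (incl w) ∈ s →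
      est w ∨ proj Γ w ∈ proj Γ '' {v | ‖((v : ClosedBall 4) : E 4)‖ ≤ r}) ?_ ?_ ?_ ?_
    · exact ⟨0, one_pos, fun w hw => absurd hw (Set.notMem_empty _)⟩
    · rintro s t hst ⟨r, hr, h⟩
      exact ⟨r, hr, fun w hw => h w (hst hw)⟩
    · rintro s t ⟨r, hr, h⟩ ⟨r', hr', h'⟩
      refine ⟨max r r', max_lt hr hr', fun w hw => ?_⟩
      rcases hw with hw | hw
      · refine (h w hw).imp_right ?_
        rintro ⟨v, hv, hvw⟩
        exact ⟨v, (show _ ≤ r from hv).trans (le_max_left _ _), hvw⟩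
      · refine (h' w hw).imp_right ?_
        rintro ⟨v, hv, hvw⟩
        exact ⟨v, (show _ ≤ r' from hv).trans (le_max_right _ _), hvw⟩
    · intro m _
      obtain ⟨v, rfl⟩ := Quotient.exists_rep m
      rcases v.2 with hv | hv
      · obtain ⟨r, h1, h2⟩ := exists_between (show ‖((v : ClosedBall 4) : E 4)‖ < 1 from hv)
        refine ⟨projBar Γ '' {u | ‖((u : ClosedBall 4) : E 4)‖ < r}, mem_nhdsWithin_of_mem_nhds
          ((isOpenMap_projBar hΓ _ (isOpen_lt (by fun_prop) continuous_const)).mem_nhds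
            ⟨v, h1, rfl⟩), r, h2, fun w hw => Or.inr ?_⟩
        obtain ⟨u, hu, huw⟩ := hw
        obtain ⟨γ, hγ, hui, h⟩ := hequiv w u huw
        exact ⟨⟨u, hui⟩, (show _ < r from hu).le, proj_eq_iff.2 ⟨γ, hγ, h⟩⟩
      · obtain ⟨O, hO, hvO, hest⟩ := exists_isOpen_estimate D μ₀ μ (c := c)
          (by push_cast; linarith) hv
        refine ⟨projBar Γ '' (Subtype.val ⁻¹' O), mem_nhdsWithin_of_mem_nhds
          ((isOpenMap_projBar hΓ _ (hO.preimage continuous_subtype_val)).mem_nhds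
            ⟨v, hvO, rfl⟩), 0, one_pos, fun w hw => Or.inl ?_⟩
        obtain ⟨u, hu, huw⟩ := hw
        obtain ⟨γ, hγ, hui, h⟩ := hequiv w u huw
        rw [← h]
        exact est_apply γ hγ _ hui (hest _ hu hui)
  refine ⟨r, hr, fun w hw => ?_⟩
  have hm : projBar Γ (incl w) ∈ C₀ ∪ ⋃ j, cuspRegion (G.cusp j) (G.R j) := by
    rw [hcover]; trivial
  rcases hm with hm | hm
  · exact (hgood w (Or.inl hm)).resolve_right hw
  · obtain ⟨j, u, hu, huw⟩ := Set.mem_iUnion.1 hm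
    obtain ⟨γ, hγ, hui, h⟩ := hequiv w u huw
    -- Where s is bounded, a stabilizer element moves u into the compact set `K j`; elsewhere the
    -- cusp hypothesis applies.
    by_cases hs : (G.cusp j).normSq u ≤ R' j
    · obtain ⟨τ, hτ, hτK⟩ := hKcov j u hu hs
      refine (hgood w (Or.inr (Set.mem_iUnion.2 ⟨j, ⟨τ u, ?_⟩, hτK, ?_⟩))).resolve_right hw
      · exact (apply_mem_innerOmega_iff hΓ hτ.1).2 u.2
      · rw [← huw]
        exact (projBar_eq_iff.2 ⟨τ, hτ.1, rfl⟩).symm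
    · change est w
      rw [← h]
      exact est_apply γ hγ _ hui (hcusp j _ hui (not_le.1 hs))

/-- Since μ₀ - μⱼ - 1 > 3/2 - 1/2 - 1 = 0, the t-term is nonnegative, so the bound 1/2 on the cusp
weights serves for every μ₀ in the range. -/
theorem asymptoticEstimate_of_rank_eq_one (D : DefiningFunctions G) {μ₀ : ℝ}
    (hμ₀ : μ₀ ∈ Set.Ioo (3 / 2 : ℝ) 2) (hrank : ∀ j, (G.cusp j).rank = 1) {μ : Fin nc → ℝ}
    (hμ : ∀ j, 0 < μ j ∧ μ j < 1 / 2) : AsymptoticEstimate D (-2) μ₀ μ := by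
  obtain ⟨h1, h2⟩ := hμ₀
  -- The difference of the two sides is (μ₀ - 1)(2 - μ₀); a constant c strictly between them
  -- provides δ = c - 2.
  have hgap : 2 < μ₀ * (3 - μ₀) := by nlinarith
  obtain ⟨c, hc2, hc⟩ := exists_between hgap
  choose R' hR' using exists_confLap_sigmaPow_cusp D
  obtain ⟨r, hr, h⟩ := exists_radius_of_cusp_estimate D hc (R' := R') (μ := μ)
    fun j w hw hs => by
      rw [hR' j μ₀ μ w hw hs, mul_comm]
      refine mul_le_mul_of_nonneg_left ?_ (sigmaPow_pos D μ₀ μ hw).le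
      have h3 : 0 ≤ (μ₀ + μ j) * (μ₀ - μ j - (G.cusp j).rank) := by
        rw [hrank]
        have := hμ j
        push_cast
        exact mul_nonneg (by linarith) (by linarith)
      have h4 : 0 ≤ (G.cusp j).normSq w := by rw [Cusp.normSq_eq]; positivity
      have h5 : 0 ≤ (G.cusp j).coord w 0 ^ 2 / (G.cusp j).normSq w := by positivity
      linarith [mul_nonneg h5 h3]
  refine ⟨_, isCompact_image_proj hr, c - 2, by linarith, fun w hw => ?_⟩
  rw [laplacian_ballMetric w.2 (contDiffAt_sigmaPow D μ₀ μ w.2)]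
  linarith [h w hw]

end

end GFHyp

theorem mainTheorem7 :
    (∀ (Γ : Subgroup (GFHyp.ClosedBall 4 ≃ₜ GFHyp.ClosedBall 4)) (nc : ℕ)
        (G : GFHyp.GeometricallyFinite Γ nc) (D : GFHyp.DefiningFunctions G)
        (μ₀ : ℝ) (μ : Fin nc → ℝ),
        (∀ j, 0 < μ j) → GFHyp.AsymptoticEstimate D (-2) μ₀ μ →
          ∀ j, (G.cusp j).rank = 1) ∧
    (∀ μ₀ : ℝ, μ₀ ∈ Set.Ioo (3 / 2 : ℝ) 2 → ∃ ε : ℝ, 0 < ε ∧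
      ∀ (Γ : Subgroup (GFHyp.ClosedBall 4 ≃ₜ GFHyp.ClosedBall 4)) (nc : ℕ)
        (G : GFHyp.GeometricallyFinite Γ nc) (D : GFHyp.DefiningFunctions G),
        (∀ j, (G.cusp j).rank = 1) →
          ∀ μ : Fin nc → ℝ, (∀ j, 0 < μ j ∧ μ j < ε) →
            GFHyp.AsymptoticEstimate D (-2) μ₀ μ) := by
  refine ⟨fun Γ nc G D μ₀ μ hμ h j => GFHyp.rank_eq_one_of_asymptoticEstimate hμ h j,
    fun μ₀ hμ₀ => ⟨1 / 2, by norm_num, fun Γ nc G D hrank μ hμ =>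
      GFHyp.asymptoticEstimate_of_rank_eq_one D hμ₀ hrank hμ⟩⟩
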